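/- Let $p$ be a prime. A $p$-series in a group $H$ is a descending series of normal subgroups $H=H_1\supseteq H_2\supseteq\cdots$ with $[H_i,H_j]\subseteq H_{i+j}$ and $H_i^p\subseteq H_{pi}$ for all $i,j\ge 1$. Its restricted Lie algebra is Lazard's algebra $L_p(H,H_i)=\bigoplus_{i\ge 1}H_i/H_{i+1}$ over $\mathbb Z/p$, whose bracket and $p$-map $x\mapsto x^{[p]}$ are induced on homogeneous elements by the commutator and the $p$-th power in $H$. A restricted Lie algebra over $\mathbb Z/p$ is free abelian of rank $r$ if it is abelian and has elements $x_1,\dots,x_r$ such that the elements $x_j^{[p]^k}$ ($1\le j\le r$, $k\ge 0$) form a basis over $\mathbb Z/p$; it is abelian of rank $r$ if it is abelian and the direct sum of a free abelian restricted subalgebra of rank $r$ and a finite restricted subalgebra. The $p$-topology on $H$ is the topology defined by the dimension subgroups $M_n=\{h\in H : h-1\in\omega^n\}$, $n\ge 1$, where $\omega$ is the augmentation ideal of the group ring $(\mathbb Z/p)H$. Theorem VIII. Let $H$ be a finitely generated group with a $p$-series $(H_i)$ such that $\bigcap_i H_i=1$ and the topology on $H$ defined by $(H_i)$ is equal to the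 $p$-topology. 1. If $L_p(H,H_i)$ is abelian of finite rank, then $H$ has a $p$-series $(U_i)$ such that every $U_i$ is a characteristic subgroup of $H$, $\bigcap_i U_i=1$, and $L_p(H,U_i)$ is abelian of finite rank. 2. If $L_p(H,H_i)$ is free abelian of finite rank, then $H$ has a $p$-series $(U_i)$ such that every $U_i$ is a characteristic subgroup of $H$, $\bigcap_i U_i=1$, and $L_p(H,U_i)$ is free abelian of finite rank. -/

import Mathlib

open scoped DirectSum commutatorElement

/-- A `p`-series `H = H₁ ⊇ H₂ ⊇ ⋯` of normal subgroups: `[Hᵢ, Hⱼ] ≤ Hᵢ₊ⱼ` and `Hᵢᵖ ≤ Hₚᵢ`.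
The series proper is `term 1, term 2, …`; by convention `term 0` is `H` as well, so that the
factor of degree `0` is trivial and the conditions with `i = 0` or `j = 0` say nothing new. -/
structure PSeries (p : ℕ) (H : Type*) [Group H] where
  term : ℕ → Subgroup H
  term_zero : term 0 = ⊤
  term_one : term 1 = ⊤
  antitone : Antitone term
  normal : ∀ i, (term i).Normal
  commutator_le : ∀ i j, ⁅term i, term j⁆ ≤ term (i + j)
  power_mem : ∀ i, ∀ h ∈ term i, h ^ p ∈ term (p * i)

/-- The topology on a group defined by a descending series of subgroups: a set is open iff with
each of its points `x` it contains one of the cosets `x Nₙ`. -/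
@[reducible] def seriesTopology {H : Type*} [Group H] (N : ℕ → Subgroup H) (hN : Antitone N) :
    TopologicalSpace H where
  IsOpen U := ∀ x ∈ U, ∃ n, ∀ h ∈ N n, x * h ∈ U
  isOpen_univ := fun _ _ => ⟨0, fun _ _ => trivial⟩
  isOpen_inter := by
    intro U V hU hV x hx
    obtain ⟨m, hm⟩ := hU x hx.1
    obtain ⟨n, hn⟩ := hV x hx.2
    exact ⟨max m n, fun h hh => ⟨hm h (hN (le_max_left m n) hh), hn h (hN (le_max_right m n) hh)⟩⟩
  isOpen_sUnion := by
    intro s hs x hx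
    obtain ⟨U, hU, hxU⟩ := hx
    obtain ⟨n, hn⟩ := hs U hU x hxU
    exact ⟨n, fun h hh => ⟨U, hU, hn h hh⟩⟩

/-- The augmentation ideal of the group ring of `H` over `ℤ/p`. -/
noncomputable def augmentationIdeal (p : ℕ) (H : Type*) [Group H] :
    Ideal (MonoidAlgebra (ZMod p) H) :=
  RingHom.ker (MonoidAlgebra.lift (ZMod p) (ZMod p) H (1 : H →* ZMod p)).toRingHom

instance augmentationIdeal_isTwoSided (p : ℕ) (H : Type*) [Group H] :
    (augmentationIdeal p H).IsTwoSided := by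
  unfold augmentationIdeal; infer_instance

/-- The dimension subgroup `Mₙ = {h | h - 1 ∈ ωⁿ}` of `H` in characteristic `p`, where `ω` is the
augmentation ideal of the group ring over `ℤ/p`. -/
noncomputable def dimensionSubgroup (p : ℕ) (H : Type*) [Group H] (n : ℕ) : Subgroup H where
  carrier := {h | MonoidAlgebra.of (ZMod p) H h - 1 ∈ augmentationIdeal p H ^ n}
  one_mem' := by
    simp only [Set.mem_ofPred_eq, map_one, sub_self]
    exact zero_mem _
  mul_mem' := by
    intro a b ha hb
    have h1 := (augmentationIdeal p H ^ n).mul_mem_left (MonoidAlgebra.of (ZMod p) H a) hb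
    have h2 := (augmentationIdeal p H ^ n).add_mem h1 ha
    simpa only [Set.mem_ofPred_eq, map_mul, mul_sub, mul_one, sub_add_sub_cancel] using h2
  inv_mem' := by
    intro a ha
    have h1 := (augmentationIdeal p H ^ n).mul_mem_left (-MonoidAlgebra.of (ZMod p) H a⁻¹) ha
    have h2 : -MonoidAlgebra.of (ZMod p) H a⁻¹ * (MonoidAlgebra.of (ZMod p) H a - 1) =
        MonoidAlgebra.of (ZMod p) H a⁻¹ - 1 := by
      rw [mul_sub, neg_mul, ← map_mul, inv_mul_cancel, map_one, mul_one, sub_neg_eq_add,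
        neg_add_eq_sub]
    rwa [h2] at h1

theorem dimensionSubgroup_antitone (p : ℕ) (H : Type*) [Group H] :
    Antitone (dimensionSubgroup p H) :=
  fun _ _ hmn _ hh => Ideal.pow_le_pow_right hmn hh

/-- The `p`-topology of `H`: the topology defined by the dimension subgroups. -/
@[reducible] noncomputable def pTopology (p : ℕ) (H : Type*) [Group H] : TopologicalSpace H :=
  seriesTopology (dimensionSubgroup p H) (dimensionSubgroup_antitone p H)

namespace PSeries

variable {p : ℕ} {H : Type*} [Group H] (S : PSeries p H)

/-- The topology defined by a `p`-series. -/
@[reducible] def topology : TopologicalSpace H := seriesTopology S.term S.antitone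

/-! ### Polynomial sequences and the `p`-th power of a product -/

section Poly

/-- `S.Poly i m d g`: the `k`-th difference of the sequence `g` has values in the term of degree
`d + k * i`, for all `k < m`. -/
def Poly (i : ℕ) : ℕ → ℕ → (ℕ → H) → Prop
  | 0, _, _ => True
  | m + 1, d, g => (∀ n, g n ∈ S.term d) ∧ Poly i m (d + i) (fun n => (g n)⁻¹ * g (n + 1))

variable {S} {i : ℕ}

theorem comm_mem {a b : ℕ} {x y : H} (hx : x ∈ S.term a) (hy : y ∈ S.term b) :
    ⁅x, y⁆ ∈ S.term (a + b) :=
  S.commutator_le a b (Subgroup.commutator_mem_commutator hx hy)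

theorem Poly.mono {m : ℕ} : ∀ {d e : ℕ} {g : ℕ → H}, e ≤ d → S.Poly i m d g → S.Poly i m e g := by
  induction m with
  | zero => intros; trivial
  | succ m ih =>
    intro d e g h hg
    exact ⟨fun n => S.antitone h (hg.1 n), ih (by omega) hg.2⟩

theorem Poly.trunc {m : ℕ} : ∀ {d : ℕ} {g : ℕ → H}, S.Poly i (m + 1) d g → S.Poly i m d g := by
  induction m with
  | zero => intros; trivial
  | succ m ih => intro d g hg; exact ⟨hg.1, ih hg.2⟩

theorem Poly.one {m : ℕ} : ∀ {d : ℕ}, S.Poly i m d (fun _ => (1 : H)) := by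
  induction m with
  | zero => intros; trivial
  | succ m ih =>
    intro d
    refine ⟨fun n => one_mem _, ?_⟩
    simpa using ih

theorem Poly.const {m d : ℕ} {c : H} (hc : c ∈ S.term d) : S.Poly i m d (fun _ => c) := by
  cases m with
  | zero => trivial
  | succ m => exact ⟨fun n => hc, by simpa using Poly.one⟩

theorem Poly.closure (i m : ℕ) :
    (∀ d (g h : ℕ → H), S.Poly i m d g → S.Poly i m d h → S.Poly i m d (fun n => g n * h n)) ∧
    (∀ d (g : ℕ → H), S.Poly i m d g → S.Poly i m d (fun n => (g n)⁻¹)) ∧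
    (∀ a b (g h : ℕ → H), S.Poly i m a g → S.Poly i m b h →
      S.Poly i m (a + b) (fun n => ⁅g n, h n⁆)) := by
  induction m with
  | zero => exact ⟨fun _ _ _ _ _ => trivial, fun _ _ _ => trivial, fun _ _ _ _ _ _ => trivial⟩
  | succ m ih =>
    obtain ⟨mulP, invP, comP⟩ := ih
    refine ⟨?_, ?_, ?_⟩
    · intro d g h hg hh
      refine ⟨fun n => mul_mem (hg.1 n) (hh.1 n), ?_⟩
      have h1 := mulP _ _ _ (mulP _ _ _ hg.2
        ((comP _ _ _ _ (invP _ _ hg.2) (invP _ _ hh.trunc)).mono (Nat.le_add_right (d + i) d)))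
        hh.2
      convert h1 using 2 with n
      simp only [commutatorElement_def]; group
    · intro d g hg
      refine ⟨fun n => inv_mem (hg.1 n), ?_⟩
      have h1 := mulP _ _ _ (invP _ _ hg.2)
        ((comP _ _ _ _ hg.2 hg.trunc).mono (Nat.le_add_right (d + i) d))
      convert h1 using 2 with n
      simp only [commutatorElement_def]; group
    · intro a b g h hg hh
      refine ⟨fun n => comm_mem (hg.1 n) (hh.1 n), ?_⟩
      set u : ℕ → H := fun n => (g n)⁻¹ * g (n + 1) with hu
      set v : ℕ → H := fun n => (h n)⁻¹ * h (n + 1) with hv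
      have hu' : S.Poly i m (a + i) u := hg.2
      have hv' : S.Poly i m (b + i) v := hh.2
      have hw : S.Poly i m (a + b) (fun n => ⁅g n, h n⁆) := comP _ _ _ _ hg.trunc hh.trunc
      -- conjugation preserves the degree
      have conjP : ∀ d e (q r : ℕ → H), S.Poly i m d q → S.Poly i m e r →
          S.Poly i m d (fun n => r n * q n * (r n)⁻¹) := by
        intro d e q r hq hr
        have := mulP _ _ _ ((comP _ _ _ _ hr hq).mono (Nat.le_add_left d e)) hq
        convert this using 2 with n
        simp only [commutatorElement_def]; group
      have c1 : S.Poly i m (a + b + i) (fun n => ⁅g n, v n⁆) :=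
        (comP _ _ _ _ hg.trunc hv').mono (by omega)
      have c2 : S.Poly i m (a + b + i) (fun n => ⁅u n, h n * v n⁆) :=
        (comP _ _ _ _ hu' (mulP _ _ _ hh.trunc (hv'.mono (Nat.le_add_right b i)))).mono (by omega)
      have c3 := conjP _ _ _ _ c1 hh.trunc
      have e1 : S.Poly i m (a + b + i) (fun n => (⁅g n, h n⁆)⁻¹ *
          (g n * ⁅u n, h n * v n⁆ * (g n)⁻¹) * ⁅g n, h n⁆) := by
        have := conjP _ _ _ _ (conjP _ _ _ _ c2 hg.trunc) (invP _ _ hw)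
        simpa using this
      have e2 := mulP _ _ _ e1 c3
      convert e2 using 2 with n
      have hg1 : g (n + 1) = g n * u n := by simp [hu]
      have hh1 : h (n + 1) = h n * v n := by simp [hv]
      beta_reduce
      rw [hg1, hh1]
      simp only [commutatorElement_def]; group

theorem Poly.choose_pow {m k : ℕ} : ∀ {d : ℕ} {c : H}, c ∈ S.term (d + k * i) → 
    S.Poly i m d (fun n => c ^ n.choose k) := by
  induction m generalizing k with
  | zero => intros; trivial
  | succ m ih =>
    intro d c hc
    refine ⟨fun n => pow_mem (S.antitone (Nat.le_add_right _ _) hc) _, ?_⟩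
    cases k with
    | zero => simpa using Poly.one
    | succ k =>
      have := ih (k := k) (d := d + i) (c := c) (by convert hc using 2; ring)
      convert this using 2 with n
      beta_reduce
      rw [Nat.choose_succ_succ', add_comm (n.choose k), pow_add, inv_mul_cancel_left]

theorem Poly.mem_of_vanish {m : ℕ} : ∀ {k d : ℕ} {g : ℕ → H}, S.Poly i m d g → k < m →
    (∀ n < k, g n = 1) → g k ∈ S.term (d + k * i) := by
  induction m with
  | zero => intro k d g _ h; omega
  | succ m ih =>
    intro k d g hg hk hv
    cases k with
    | zero => simpa using hg.1 0
    | succ k =>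
      have := ih hg.2 (k := k) (by omega) (by
        intro n hn
        simp [hv n (by omega), hv (n + 1) (by omega)])
      rw [hv k (by omega)] at this
      simp only [inv_one, one_mul] at this
      convert this using 2; ring

theorem Poly.prime_mem [hp : Fact p.Prime] {g : ℕ → H} (hg : S.Poly i (p + 1) 1 g)
    (h0 : g 0 = 1) : g p ∈ S.term (p * i + 1) := by
  have hp2 : 1 ≤ p := hp.out.one_le
  have key : ∀ r, ∀ k, k + r = p → 1 ≤ k → ∀ g : ℕ → H, S.Poly i (p + 1) 1 g →
      (∀ n < k, g n = 1) → g p ∈ S.term (p * i + 1) := by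
    intro r
    induction r with
    | zero =>
      intro k hk _ g hg hv
      obtain rfl : k = p := by omega
      have := hg.mem_of_vanish (k := k) (by omega) hv
      rwa [add_comm] at this
    | succ r ih =>
      intro k hk hk1 g hg hv
      have hc : g k ∈ S.term (1 + k * i) := hg.mem_of_vanish (by omega) hv
      obtain ⟨q, hq⟩ := hp.out.dvd_choose_self (k := k) (by omega) (by omega)
      have h1 : S.Poly i (p + 1) 1 (fun n => (g k ^ n.choose k)⁻¹ * g n) :=
        (Poly.closure i (p + 1)).1 _ _ _
          ((Poly.closure i (p + 1)).2.1 _ _ (Poly.choose_pow hc)) hg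
      have h2 := ih (k + 1) (by omega) (by omega) _ h1 (by
        intro n hn
        rcases Nat.lt_succ_iff_lt_or_eq.1 hn with h | h
        · simp [hv n h, Nat.choose_eq_zero_of_lt h]
        · subst h; simp)
      have h3 : g k ^ p.choose k ∈ S.term (p * i + 1) := by
        rw [hq, pow_mul]
        refine pow_mem (S.antitone ?_ (S.power_mem _ _ hc)) q
        have : p * i ≤ p * (k * i) := Nat.mul_le_mul_left p (Nat.le_mul_of_pos_left i hk1)
        rw [mul_add]; omega
      have h4 := mul_mem h3 h2
      simpa using h4
  exact key (p - 1) 1 (by omega) le_rfl g hg (by intro n hn; obtain rfl : n = 0 := by omega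
                                                 exact h0)

/-- The `p`-th power map is compatible with passing to the factors of a `p`-series. -/
theorem inv_pow_mul_pow_mem [Fact p.Prime] {x z : H} (hx : x ∈ S.term i)
    (hz : z ∈ S.term (i + 1)) : (x ^ p)⁻¹ * (x * z) ^ p ∈ S.term (p * i + 1) := by
  have key : ∀ m, S.Poly i m 1 (fun n => (x ^ n)⁻¹ * (x * z) ^ n) := by
    intro m
    induction m with
    | zero => trivial
    | succ m ih =>
      refine ⟨fun n => by rw [S.term_one]; trivial, ?_⟩
      have h1 := (Poly.closure i m).2.2 _ _ _ _ ((Poly.closure i m).2.1 _ _ ih)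
        (Poly.const (inv_mem hx))
      have h2 := (Poly.closure i m).1 _ _ _ h1 (Poly.const (c := z) (by rwa [add_comm]))
      convert h2 using 2 with n
      simp only [commutatorElement_def, pow_succ]; group
  exact (key (p + 1)).prime_mem (by simp)

end Poly

/-! ### The associated restricted Lie algebra -/

section LieAlg

instance term_normal (i : ℕ) : (S.term i).Normal := S.normal i

theorem term_mem_of_le {a b : ℕ} (hab : a ≤ b) {h : H} (hh : h ∈ S.term b) : h ∈ S.term a :=
  S.antitone hab hh

/-- The factor `Hᵢ / Hᵢ₊₁`. -/
def Factor (i : ℕ) : Type _ := Additive (S.term i ⧸ (S.term (i + 1)).subgroupOf (S.term i))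

/-- The class in `Hᵢ / Hᵢ₊₁` of an element of `Hᵢ`. -/
def cls (i : ℕ) (h : S.term i) : S.Factor i := Additive.ofMul (QuotientGroup.mk h)

variable {S} in
theorem cls_surj {i : ℕ} (x : S.Factor i) : ∃ h, S.cls i h = x := by
  obtain ⟨h, hh⟩ := QuotientGroup.mk_surjective (Additive.toMul x)
  exact ⟨h, hh⟩

theorem cls_eq_cls {i : ℕ} {a b : S.term i} :
    S.cls i a = S.cls i b ↔ (a : H)⁻¹ * b ∈ S.term (i + 1) := by
  change (QuotientGroup.mk a : S.term i ⧸ (S.term (i + 1)).subgroupOf (S.term i)) =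
    QuotientGroup.mk b ↔ _
  rw [QuotientGroup.eq, Subgroup.mem_subgroupOf]
  simp

theorem comm_mem_succ {i : ℕ} {a b : H} (ha : a ∈ S.term i) (hb : b ∈ S.term i) :
    ⁅a, b⁆ ∈ S.term (i + 1) := by
  rcases Nat.eq_zero_or_pos i with rfl | hi
  · rw [zero_add, S.term_one]; trivial
  · exact S.antitone (by omega) (comm_mem ha hb)

instance (i : ℕ) : AddCommGroup (S.Factor i) :=
  { (inferInstance : AddGroup (Additive (S.term i ⧸ (S.term (i + 1)).subgroupOf (S.term i)))) with
    add_comm := by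
      intro x y
      obtain ⟨a, rfl⟩ := cls_surj (S := S) x
      obtain ⟨b, rfl⟩ := cls_surj (S := S) y
      change S.cls i (a * b) = S.cls i (b * a)
      rw [cls_eq_cls]
      have := S.comm_mem_succ (inv_mem b.2) (inv_mem a.2)
      simpa [commutatorElement_def, mul_assoc] using this }

theorem cls_mul {i : ℕ} (a b : S.term i) : S.cls i (a * b) = S.cls i a + S.cls i b := rfl

theorem cls_one {i : ℕ} : S.cls i 1 = 0 := rfl

theorem cls_inv {i : ℕ} (a : S.term i) : S.cls i a⁻¹ = -S.cls i a := rfl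

theorem cls_pow {i : ℕ} (a : S.term i) (n : ℕ) : S.cls i (a ^ n) = n • S.cls i a := rfl

theorem cls_eq_zero {i : ℕ} {a : S.term i} : S.cls i a = 0 ↔ (a : H) ∈ S.term (i + 1) := by
  rw [← cls_one, eq_comm, cls_eq_cls]; simp

theorem cls_conj {i : ℕ} (g : H) (a : S.term i) :
    S.cls i ⟨g * a * g⁻¹, (S.normal i).conj_mem a a.2 g⟩ = S.cls i a := by
  rw [eq_comm, cls_eq_cls]
  have hg : g ∈ S.term 1 := by rw [S.term_one]; trivial
  have := comm_mem (inv_mem a.2) hg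
  simpa [commutatorElement_def, mul_assoc] using this

instance [hp : Fact p.Prime] (i : ℕ) : Module (ZMod p) (S.Factor i) := AddCommGroup.zmodModule (by
  intro x
  obtain ⟨a, rfl⟩ := cls_surj (S := S) x
  rw [← cls_pow, cls_eq_zero]
  have h1 := S.power_mem i a a.2
  rcases Nat.eq_zero_or_pos i with rfl | hi
  · rw [zero_add, S.term_one]; trivial
  · refine S.antitone ?_ h1
    have := Nat.mul_le_mul_right i hp.out.two_le
    omega)

/-- The commutator of representatives, as a map `Hᵢ/Hᵢ₊₁ × Hⱼ/Hⱼ₊₁ → Hᵢ₊ⱼ/Hᵢ₊ⱼ₊₁`. -/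
def commFun (i j : ℕ) (x : S.Factor i) (y : S.Factor j) : S.Factor (i + j) :=
  Quotient.liftOn₂' (Additive.toMul x) (Additive.toMul y)
    (fun a b => S.cls (i + j) ⟨⁅(a : H), (b : H)⁆, comm_mem a.2 b.2⟩) (by
      intro a b a' b' ha hb
      rw [QuotientGroup.leftRel_apply, Subgroup.mem_subgroupOf] at ha hb
      obtain ⟨u, hu⟩ : ∃ u, u = (a : H)⁻¹ * a' := ⟨_, rfl⟩
      obtain ⟨v, hv⟩ : ∃ v, v = (b : H)⁻¹ * b' := ⟨_, rfl⟩
      have ha' : (a' : H) = a * u := by simp [hu]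
      have hb' : (b' : H) = b * v := by simp [hv]
      have hu1 : u ∈ S.term (i + 1) := by simpa [hu] using ha
      have hv1 : v ∈ S.term (j + 1) := by simpa [hv] using hb
      rw [cls_eq_cls]
      simp only [ha', hb']
      have h1 : ⁅u, (b : H) * v⁆ ∈ S.term (i + j + 1) :=
        S.antitone (by omega) (comm_mem hu1 (mul_mem b.2 (S.antitone (Nat.le_succ j) hv1)))
      have h2 : ⁅(a : H), v⁆ ∈ S.term (i + j + 1) := S.antitone (by omega) (comm_mem a.2 hv1)
      have h3 := (S.normal _).conj_mem _ ((S.normal _).conj_mem _ h1 a) (⁅(a : H), (b : H)⁆⁻¹)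
      have h4 := mul_mem h3 ((S.normal _).conj_mem _ h2 b)
      convert h4 using 1
      simp only [commutatorElement_def]; group)

theorem commFun_cls {i j : ℕ} (a : S.term i) (b : S.term j) :
    S.commFun i j (S.cls i a) (S.cls j b) =
      S.cls (i + j) ⟨⁅(a : H), (b : H)⁆, comm_mem a.2 b.2⟩ := rfl

/-- The underlying additive group `⨁ᵢ Hᵢ / Hᵢ₊₁` of the restricted Lie algebra `L_p(H, Hᵢ)`. -/
def LieAlg : Type _ := ⨁ i, S.Factor i

noncomputable instance : AddCommGroup S.LieAlg := inferInstanceAs (AddCommGroup (⨁ i, S.Factor i))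

noncomputable instance [Fact p.Prime] : Module (ZMod p) S.LieAlg :=
  inferInstanceAs (Module (ZMod p) (⨁ i, S.Factor i))

/-- The inclusion of the homogeneous component of degree `i`. -/
noncomputable def of (i : ℕ) : S.Factor i →+ S.LieAlg := DirectSum.of S.Factor i

/-- The homogeneous component of degree `i` of an element. -/
noncomputable def component (i : ℕ) : S.LieAlg →+ S.Factor i :=
  (DirectSum.component ℕ ℕ S.Factor i).toAddMonoidHom

theorem of_cls_congr {i j : ℕ} (hij : i = j) {a : S.term i} {b : S.term j}
    (hab : (a : H) = b) : S.of i (S.cls i a) = S.of j (S.cls j b) := by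
  subst hij
  rw [Subtype.ext hab]

/-- Additive maps out of `L_p(H, Hᵢ)` agree if they agree on homogeneous elements. -/
theorem hom_ext {A : Type*} [AddCommMonoid A] {f g : S.LieAlg →+ A}
    (h : ∀ i (a : S.term i), f (S.of i (S.cls i a)) = g (S.of i (S.cls i a))) : f = g := by
  refine DirectSum.addHom_ext (f := f) (g := g) ?_
  intro i x
  obtain ⟨a, rfl⟩ := cls_surj (S := S) x
  exact h i a

/-- The additive map out of `⨁ᵢ Hᵢ / Hᵢ₊₁` given by additive maps out of the components. -/
noncomputable def liftHom {A : Type*} [AddCommMonoid A] (f : ∀ i, S.Factor i →+ A) :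
    S.LieAlg →+ A :=
  DirectSum.toAddMonoid (β := S.Factor) f

theorem liftHom_of {A : Type*} [AddCommMonoid A] (f : ∀ i, S.Factor i →+ A) (i : ℕ)
    (x : S.Factor i) : S.liftHom f (S.of i x) = f i x :=
  DirectSum.toAddMonoid_of f i x

/-- The bracket of homogeneous elements, as a biadditive map. -/
noncomputable def commHom (i j : ℕ) : S.Factor i →+ S.Factor j →+ S.LieAlg :=
  AddMonoidHom.mk' (fun x => AddMonoidHom.mk' (fun y => S.of (i + j) (S.commFun i j x y)) (by
    intro x' y'
    obtain ⟨a, rfl⟩ := cls_surj (S := S) x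
    obtain ⟨b, rfl⟩ := cls_surj (S := S) x'
    obtain ⟨c, rfl⟩ := cls_surj (S := S) y'
    rw [← cls_mul, commFun_cls, commFun_cls, commFun_cls, ← map_add,
      ← S.cls_conj b ⟨⁅(a : H), (c : H)⁆, _⟩, ← cls_mul]
    refine S.of_cls_congr rfl ?_
    simp only [Subgroup.coe_mul, commutatorElement_def]; group)) (by
  intro x y
  ext z
  obtain ⟨a, rfl⟩ := cls_surj (S := S) x
  obtain ⟨b, rfl⟩ := cls_surj (S := S) y
  obtain ⟨c, rfl⟩ := cls_surj (S := S) z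
  simp only [AddMonoidHom.mk'_apply, AddMonoidHom.add_apply]
  rw [← cls_mul, commFun_cls, commFun_cls, commFun_cls, ← map_add,
    add_comm (S.cls _ ⟨⁅(a : H), (c : H)⁆, _⟩),
    ← S.cls_conj a ⟨⁅(b : H), (c : H)⁆, _⟩, ← cls_mul]
  refine S.of_cls_congr rfl ?_
  simp only [Subgroup.coe_mul, commutatorElement_def]; group)

/-- The bracket of `L_p(H, Hᵢ)`: the biadditive extension of the commutator of representatives. -/
noncomputable def bracketHom : S.LieAlg →+ S.LieAlg →+ S.LieAlg :=
  S.liftHom fun i => AddMonoidHom.flip (S.liftHom fun j => (S.commHom i j).flip)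

noncomputable instance : Bracket S.LieAlg S.LieAlg := ⟨fun x y => S.bracketHom x y⟩

theorem bracket_def (x y : S.LieAlg) : ⁅x, y⁆ = S.bracketHom x y := rfl

theorem bracket_of_cls {i j : ℕ} (a : S.term i) (b : S.term j) :
    ⁅S.of i (S.cls i a), S.of j (S.cls j b)⁆ =
      S.of (i + j) (S.cls (i + j) ⟨⁅(a : H), (b : H)⁆, comm_mem a.2 b.2⟩) := by
  rw [bracket_def, bracketHom, liftHom_of, AddMonoidHom.flip_apply, liftHom_of]
  rfl

theorem bracket_skew (x y : S.LieAlg) : ⁅x, y⁆ = -⁅y, x⁆ := by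
  suffices h : S.bracketHom = -S.bracketHom.flip from DFunLike.congr_fun (DFunLike.congr_fun h x) y
  refine S.hom_ext fun i a => S.hom_ext fun j b => ?_
  change ⁅S.of i (S.cls i a), S.of j (S.cls j b)⁆ = -⁅S.of j (S.cls j b), S.of i (S.cls i a)⁆
  rw [bracket_of_cls, bracket_of_cls, ← map_neg, ← cls_inv]
  exact S.of_cls_congr (add_comm i j) (by simp)

theorem bracket_jacobi (x y z : S.LieAlg) : ⁅⁅x, y⁆, z⁆ + ⁅⁅y, z⁆, x⁆ + ⁅⁅z, x⁆, y⁆ = 0 := by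
  let B := S.bracketHom
  -- the three cyclic terms as triadditive maps
  let T1 : S.LieAlg →+ S.LieAlg →+ S.LieAlg →+ S.LieAlg :=
    AddMonoidHom.mk' (fun x => AddMonoidHom.mk' (fun y => B (B x y)) (by intros; simp))
      (by intros; ext; simp)
  let T2 : S.LieAlg →+ S.LieAlg →+ S.LieAlg →+ S.LieAlg :=
    AddMonoidHom.mk' (fun x => AddMonoidHom.mk' (fun y => AddMonoidHom.mk' (fun z => B (B y z) x)
      (by intros; simp)) (by intros; ext; simp)) (by intros; ext; simp)
  let T3 : S.LieAlg →+ S.LieAlg →+ S.LieAlg →+ S.LieAlg :=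
    AddMonoidHom.mk' (fun x => AddMonoidHom.mk' (fun y => AddMonoidHom.mk' (fun z => B (B z x) y)
      (by intros; simp)) (by intros; ext; simp)) (by intros; ext; simp)
  suffices h : T1 + T2 + T3 = 0 from
    DFunLike.congr_fun (DFunLike.congr_fun (DFunLike.congr_fun h x) y) z
  refine S.hom_ext fun i a => S.hom_ext fun j b => S.hom_ext fun k c => ?_
  change ⁅⁅S.of i (S.cls i a), S.of j (S.cls j b)⁆, S.of k (S.cls k c)⁆ +
    ⁅⁅S.of j (S.cls j b), S.of k (S.cls k c)⁆, S.of i (S.cls i a)⁆ +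
    ⁅⁅S.of k (S.cls k c), S.of i (S.cls i a)⁆, S.of j (S.cls j b)⁆ = 0
  rw [← S.cls_conj (b : H) c, bracket_of_cls S a b, bracket_of_cls, S.cls_conj (b : H) c,
    bracket_of_cls S b c, ← S.cls_conj (c : H) a, bracket_of_cls, S.cls_conj (c : H) a,
    bracket_of_cls S c a, ← S.cls_conj (a : H) b, bracket_of_cls]
  have h1 : j + k + i = i + j + k := by omega
  have h2 : k + i + j = i + j + k := by omega
  have hcast : ∀ {m n : ℕ} (hmn : m = n) (w : S.term m),
      S.of m (S.cls m w) = S.of n (S.cls n ⟨w, hmn ▸ w.2⟩) :=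
    fun hmn w => S.of_cls_congr hmn rfl
  rw [hcast h1, hcast h2, ← map_add, ← map_add, ← cls_mul,
    ← cls_mul]
  have : ∀ (n : ℕ) (w : S.term n), (w : H) = 1 → S.of n (S.cls n w) = 0 := by
    intro n w hw
    obtain rfl : w = 1 := Subtype.ext hw
    rw [cls_one, map_zero]
  exact this _ _ (commutatorElement_commutatorElement_conj_mul (a : H) b c)

theorem bracket_self (x : S.LieAlg) : ⁅x, x⁆ = 0 := by
  have hadd : ∀ y z : S.LieAlg, ⁅y, y⁆ = 0 → ⁅z, z⁆ = 0 → ⁅y + z, y + z⁆ = 0 := by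
    intro y z hy hz
    rw [bracket_def] at hy hz ⊢
    rw [map_add S.bracketHom y z, AddMonoidHom.add_apply, map_add, map_add, hy, hz, ← bracket_def, ← bracket_def,
      bracket_skew S y z]
    simp
  refine DirectSum.induction_on (motive := fun x : S.LieAlg => ⁅x, x⁆ = 0) x ?_ ?_ hadd
  · exact map_zero (S.bracketHom 0)
  · intro i y
    obtain ⟨a, rfl⟩ := cls_surj (S := S) y
    refine (S.bracket_of_cls a a).trans ?_
    rw [← map_zero (S.of (i + i)), ← cls_one]
    exact S.of_cls_congr rfl (by simp)

noncomputable instance : LieRing S.LieAlg where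
  add_lie x y z := by simp [bracket_def]
  lie_add x y z := by simp [bracket_def]
  lie_self := S.bracket_self
  leibniz_lie x y z := by
    have h := S.bracket_jacobi x y z
    rw [S.bracket_skew x ⁅y, z⁆, S.bracket_skew y ⁅x, z⁆, S.bracket_skew x z]
    have h' : ⁅-⁅z, x⁆, y⁆ = -⁅⁅z, x⁆, y⁆ := by simp [bracket_def]
    rw [h', neg_neg, neg_eq_iff_add_eq_zero, ← h]
    abel

noncomputable instance [Fact p.Prime] : LieAlgebra (ZMod p) S.LieAlg where
  lie_smul c x y := ZMod.map_smul (S.bracketHom x) c y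

/-- The `p`-th power of representatives, as a map `Hᵢ/Hᵢ₊₁ → Hₚᵢ/Hₚᵢ₊₁`. -/
def powFun [Fact p.Prime] (i : ℕ) (x : S.Factor i) : S.Factor (p * i) :=
  Quotient.liftOn' (Additive.toMul x)
    (fun a => S.cls (p * i) ⟨(a : H) ^ p, S.power_mem i a a.2⟩) (by
      intro a b hab
      rw [QuotientGroup.leftRel_apply, Subgroup.mem_subgroupOf] at hab
      rw [cls_eq_cls]
      have := inv_pow_mul_pow_mem a.2 hab
      simpa using this)

end LieAlg

end PSeries

/-- Jacobson's Lie polynomial `∑ᵢ sᵢ(a, b)`, `1 ≤ i ≤ p - 1`, where `i • sᵢ(a, b)` is the coefficient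
of `tⁱ⁻¹` in `ad (t a + b) ^ (p - 1) (a)`, i.e. the sum of all `⁅c₁, ⁅c₂, … ⁅cₚ₋₁, a⁆ …⁆⁆` with
`cₖ ∈ {a, b}` and exactly `i - 1` of them equal to `a`. In a restricted Lie algebra
`(a + b)^[p] = a^[p] + b^[p] + ∑ᵢ sᵢ(a, b)`. (The one word with `i = p` is zero.) -/
noncomputable def jacobsonPoly (p : ℕ) {L : Type*} [LieRing L] [LieAlgebra (ZMod p) L] (a b : L) :
    L :=
  ∑ c : Fin (p - 1) → Bool,
    ((((List.ofFn c).count true + 1 : ℕ) : ZMod p)⁻¹) •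
      (List.ofFn c).foldr (fun e y => ⁅if e then a else b, y⁆) a

namespace PSeries

variable {p : ℕ} [Fact p.Prime] {H : Type*} [Group H] (S : PSeries p H)

/-- The `p`-th power in `L_p(H, Hᵢ)` of the sum of the homogeneous components of `x` of degree
less than `n`: a homogeneous element is raised to the `p`-th power by means of a representative,
and a sum by Jacobson's formula. -/
noncomputable def pMapBelow (x : S.LieAlg) : ℕ → S.LieAlg
  | 0 => 0
  | n + 1 => pMapBelow x n + S.of (p * n) (S.powFun n (S.component n x)) +
      jacobsonPoly p (∑ i ∈ Finset.range n, S.of i (S.component i x)) (S.of n (S.component n x))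

/-- The `p`-map `x ↦ x^[p]` of the restricted Lie algebra `L_p(H, Hᵢ)`. -/
noncomputable def pMap (x : S.LieAlg) : S.LieAlg :=
  S.pMapBelow x (sInf {n | ∀ i, n ≤ i → S.component i x = 0})

/-- The restricted Lie subalgebra `T` of `L_p(H, Hᵢ)` is free abelian of rank `r`: it is abelian
and has a free system of generators `x₁, …, x_r`, that is, the elements `xⱼ^[p]ᵏ` with
`j = 1, …, r` and `k = 0, 1, …` form a basis of `T` over `ℤ/p`. -/
def IsFreeAbelianOn (T : LieSubalgebra (ZMod p) S.LieAlg) (r : ℕ) : Prop :=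
  IsLieAbelian T ∧ ∃ x : Fin r → S.LieAlg,
    LinearIndependent (ZMod p) (fun jk : Fin r × ℕ => S.pMap^[jk.2] (x jk.1)) ∧
    Submodule.span (ZMod p) (Set.range fun jk : Fin r × ℕ => S.pMap^[jk.2] (x jk.1)) =
      T.toSubmodule

/-- `L_p(H, Hᵢ)` is free abelian of rank `r`. -/
def IsFreeAbelianOfRank (r : ℕ) : Prop := S.IsFreeAbelianOn ⊤ r

/-- `L_p(H, Hᵢ)` is abelian of rank `r`: it is abelian and the direct sum of two restricted
subalgebras `T` and `T₀`, where `T` is free abelian of rank `r` and `T₀` is finite. -/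
def IsAbelianOfRank (r : ℕ) : Prop :=
  IsLieAbelian S.LieAlg ∧ ∃ T T₀ : LieSubalgebra (ZMod p) S.LieAlg,
    (∀ x ∈ T, S.pMap x ∈ T) ∧ (∀ x ∈ T₀, S.pMap x ∈ T₀) ∧
    IsCompl T.toSubmodule T₀.toSubmodule ∧
    S.IsFreeAbelianOn T r ∧ (T₀ : Set S.LieAlg).Finite

end PSeries

/-!
The series `(Uᵢ)` is the characteristic core of `(Hᵢ)`: `Uᵢ` consists of the elements whose images
under all automorphisms of `H` lie in `Hᵢ` (`PSeries.charCore`). The properties of a `p`-series, the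
triviality of the intersection, the vanishing of the bracket, and the injectivity of the `p`-map in
a given degree pass from `(Hᵢ)` to `(Uᵢ)` at once. What needs an argument is that the rank stays
finite.

If `L = L_p(H, Hᵢ)` is abelian, its `p`-map `τ` is additive, so `L` is a module over the polynomial
ring `(ℤ/p)[τ]`, graded in the sense that `τ` multiplies degrees by `p`. By the structure theorem
over this principal ideal domain, `L` is abelian of finite rank iff it is finitely generated, and
free iff moreover `τ` is injective. In terms of the factors, finite generation means that every
`Hᵢ / Hᵢ₊₁` is finite and that from some degree `N` on the `p`-th power maps `Hₙ / Hₙ₊₁`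
bijectively onto `Hₚₙ / Hₚₙ₊₁`, the factors of large degree prime to `p` being trivial
(`PSeries.PowBijectiveFrom`, `PSeries.IsAbelianOfRank.exists_powBijectiveFrom`,
`PSeries.PowBijectiveFrom.exists_isAbelianOfRank`).

For such a series, sections of exponent `p` have bounded order: if `B ≤ A` is open and contains the
`p`-th powers of `A`, comparing the filtrations which `(Hᵢ)` induces on `A` and `B` through `τ`
bounds the index of `B` in `A` by a constant (`PSeries.PowBijectiveFrom.relIndex_le_of_pow_mem`).
This applies to `A = Uₙ` and `B = Uₚₙ`. These subgroups are open because every `Hᵢ` contains a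
dimension subgroup, which is open and characteristic and so lies in `Uᵢ`
(`PSeries.exists_term_le_charCore`). Finally, since the `p`-th power is injective on the factors of
`(Uᵢ)` of large degree, the index of `Uₚₙ` in `Uₙ` is eventually nondecreasing in `n`; being
bounded, it is eventually constant, and this makes the `p`-th power bijective
(`PSeries.exists_powBijectiveFrom_of_relIndex_le`).
-/

/-! ### Linear algebra over the polynomial ring -/

open Polynomial in
/-- The structure theorem for finitely generated `K[X]`-modules, read as a statement about the
endomorphism `τ` by which `X` acts: a free part, with a `K`-basis of the elements `τᵏ xⱼ`, and the
torsion submodule as a complement. It applies to `L_p(H, Hᵢ)` with the `p`-map as `τ`. -/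
theorem exists_free_isCompl_torsion {K V : Type*} [Field K] [AddCommGroup V] [Module K V]
    (τ : Module.End K V) [Module.Finite K[X] (Module.AEval' τ)] :
    ∃ (r : ℕ) (x : Fin r → V) (T₀ : Submodule K V), (∀ v ∈ T₀, τ v ∈ T₀) ∧
      (∀ v ∈ T₀, ∃ q : K[X], q ≠ 0 ∧ aeval τ q v = 0) ∧
      LinearIndependent K (fun jk : Fin r × ℕ => (τ ^ jk.2) (x jk.1)) ∧
      IsCompl (Submodule.span K (Set.range fun jk : Fin r × ℕ => (τ ^ jk.2) (x jk.1))) T₀ := by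
  set M := Module.AEval' τ with hM
  set N : Submodule K[X] M := Submodule.torsion K[X] M with hN
  let e : V ≃ₗ[K] M := Module.AEval'.of τ
  -- `V` modulo torsion is free, so the projection onto it splits
  obtain ⟨s, hs⟩ := Module.projective_lifting_property N.mkQ LinearMap.id N.mkQ_surjective
  have hs' : ∀ q, N.mkQ (s q) = q := fun q => DFunLike.congr_fun hs q
  let b := Module.finBasis K[X] (M ⧸ N)
  let B := (Polynomial.basisMonomials K).smulTower' b
  let σ : (M ⧸ N) →ₗ[K] V := e.symm.toLinearMap ∘ₗ s.restrictScalars K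
  have hσ : ∀ q, N.mkQ (e (σ q)) = q := fun q => by simp [σ, hs']
  have hσi : Function.Injective σ := Function.LeftInverse.injective hσ
  have hfam : (fun jk : Fin _ × ℕ => (τ ^ jk.2) (e.symm (s (b jk.1)))) = σ ∘ B := by
    funext jk
    apply e.injective
    have h1 := Module.AEval'.X_pow_smul_of τ (e.symm (s (b jk.1))) jk.2
    have h2 : e (σ (B jk)) = (X ^ jk.2 : K[X]) • s (b jk.1) := by
      simp [σ, B, Module.Basis.smulTower'_apply, Polynomial.X_pow_eq_monomial]
    rw [Function.comp_apply, h2]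
    exact h1.symm
  have hmem : ∀ v, v ∈ (N.restrictScalars K).comap e.toLinearMap ↔ N.mkQ (e v) = 0 := by
    intro v
    simp
  refine ⟨_, fun j => e.symm (s (b j)), (N.restrictScalars K).comap e.toLinearMap, ?_, ?_, ?_, ?_⟩
  · intro v hv
    have h1 : e (τ v) = (X : K[X]) • e v := (Module.AEval'.X_smul_of τ v).symm
    change e (τ v) ∈ N
    rw [h1]
    exact N.smul_mem _ hv
  · intro v hv
    obtain ⟨a, ha⟩ := (Submodule.mem_torsion_iff (R := K[X]) (e v)).1 hv
    refine ⟨a, nonZeroDivisors.coe_ne_zero a, ?_⟩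
    apply e.injective
    rw [map_zero, ← ha]
    exact Module.AEval.of_aeval_smul (R := K) (M := V) (a := τ) (a : K[X]) v
  · rw [hfam]
    exact B.linearIndependent.map' σ (LinearMap.ker_eq_bot.2 hσi)
  · rw [hfam, Set.range_comp, ← Submodule.map_span, B.span_eq, Submodule.map_top]
    constructor
    · rw [Submodule.disjoint_def]
      rintro _ ⟨q, rfl⟩ h
      rw [hmem, hσ] at h
      rw [h, map_zero]
    · rw [codisjoint_iff, eq_top_iff]
      intro v _
      refine Submodule.mem_sup.2 ⟨σ (N.mkQ (e v)), ⟨_, rfl⟩, v - σ (N.mkQ (e v)), ?_, by simp⟩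
      rw [hmem, map_sub, map_sub, hσ, sub_self]

namespace PSeries

/-! ### Homogeneous components and abelian Lie algebras -/

variable {p : ℕ} {H : Type*} [Group H] (S : PSeries p H)

theorem isLieAbelian_iff :
    IsLieAbelian S.LieAlg ↔ ∀ i j, ∀ a ∈ S.term i, ∀ b ∈ S.term j, ⁅a, b⁆ ∈ S.term (i + j + 1) := by
  constructor
  · intro h i j a ha b hb
    have h1 := S.bracket_of_cls ⟨a, ha⟩ ⟨b, hb⟩
    rw [trivial_lie_zero, ← map_zero (S.of (i + j))] at h1
    exact S.cls_eq_zero.1 (DirectSum.of_injective (β := S.Factor) _ h1).symm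
  · intro h
    have h0 : S.bracketHom = 0 := by
      refine S.hom_ext fun i a => S.hom_ext fun j b => ?_
      change ⁅S.of i (S.cls i a), S.of j (S.cls j b)⁆ = 0
      rw [bracket_of_cls, S.cls_eq_zero.2 (h i j _ a.2 _ b.2), map_zero]
    exact ⟨fun x y => by rw [bracket_def, h0]; rfl⟩

theorem component_of_same (i : ℕ) (x : S.Factor i) : S.component i (S.of i x) = x :=
  DirectSum.of_eq_same (β := S.Factor) i x

theorem component_of_ne {i j : ℕ} (h : i ≠ j) (x : S.Factor i) : S.component j (S.of i x) = 0 :=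
  DirectSum.of_eq_of_ne (β := S.Factor) i j x h.symm

theorem lieAlg_ext {x y : S.LieAlg} (h : ∀ i, S.component i x = S.component i y) : x = y :=
  DFinsupp.ext h

instance factor_zero_subsingleton : Subsingleton (S.Factor 0) := by
  refine ⟨fun x y => ?_⟩
  obtain ⟨a, rfl⟩ := cls_surj x
  obtain ⟨b, rfl⟩ := cls_surj y
  rw [cls_eq_cls, zero_add, S.term_one]
  trivial

theorem exists_bound (x : S.LieAlg) : ∃ n, ∀ i, n ≤ i → S.component i x = 0 := by
  classical
  obtain ⟨n, hn⟩ := (DFinsupp.support (β := S.Factor) x).bddAbove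
  refine ⟨n + 1, fun i hi => ?_⟩
  by_contra h
  have := hn (DFinsupp.mem_support_toFun (β := S.Factor) x i |>.2 h)
  omega

theorem exists_bound_of_finite {s : Set S.LieAlg} (hs : s.Finite) :
    ∃ n, ∀ x ∈ s, ∀ i, n ≤ i → S.component i x = 0 := by
  choose f hf using S.exists_bound
  obtain ⟨n, hn⟩ := (hs.image f).bddAbove
  exact ⟨n, fun x hx i hi => hf x i ((hn ⟨x, hx, rfl⟩).trans hi)⟩

theorem component_sum_range (x : S.LieAlg) (n j : ℕ) :
    S.component j (∑ i ∈ Finset.range n, S.of i (S.component i x)) =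
      if j < n then S.component j x else 0 := by
  rw [map_sum]
  split_ifs with h
  · rw [Finset.sum_eq_single j, component_of_same]
    · intro i _ hij
      exact S.component_of_ne hij _
    · intro hj
      exact absurd (Finset.mem_range.2 h) hj
  · refine Finset.sum_eq_zero fun i hi => S.component_of_ne ?_ _
    have := Finset.mem_range.1 hi
    omega

theorem sum_range_of_component {x : S.LieAlg} {n : ℕ}
    (hn : ∀ i, n ≤ i → S.component i x = 0) :
    ∑ i ∈ Finset.range n, S.of i (S.component i x) = x := by
  refine S.lieAlg_ext fun j => ?_
  rw [component_sum_range]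
  split_ifs with h
  · rfl
  · rw [hn j (by omega)]

variable [hp : Fact p.Prime]

theorem powFun_cls {i : ℕ} (a : S.term i) :
    S.powFun i (S.cls i a) = S.cls (p * i) ⟨(a : H) ^ p, S.power_mem i a a.2⟩ := rfl

/-- If `L_p(H, Hᵢ)` is abelian, the `p`-th power is multiplicative on `Hᵢ` modulo `Hₚᵢ₊₁`. The
sequence `n ↦ y⁻ⁿ x⁻ⁿ (x y)ⁿ` has its `k`-th difference in degree `1 + k * i`, because
`⁅x⁻¹, y⁻ⁿ⁆` lies one degree deeper than it would in a general `p`-series. -/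
theorem mul_pow_mem_of_isLieAbelian (hab : IsLieAbelian S.LieAlg) {i : ℕ} {x y : H}
    (hx : x ∈ S.term i) (hy : y ∈ S.term i) :
    (y ^ p)⁻¹ * (x ^ p)⁻¹ * (x * y) ^ p ∈ S.term (p * i + 1) := by
  rw [isLieAbelian_iff] at hab
  have pow0 : ∀ m, ∀ {z : H}, z ∈ S.term i → S.Poly i m 0 (fun n => z ^ n) := by
    intro m z hz
    cases m with
    | zero => trivial
    | succ m =>
      refine ⟨fun n => by rw [S.term_zero]; trivial, ?_⟩
      have h1 : S.Poly i m (0 + i) (fun _ => z) := Poly.const (by simpa using hz)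
      convert h1 using 2 with n
      simp [pow_succ]
  have com1 : ∀ m, S.Poly i m (1 + i) (fun n => ⁅x⁻¹, y⁻¹ ^ n⁆) := by
    intro m
    have hc := hab i i _ (inv_mem hx) _ (inv_mem hy)
    cases m with
    | zero => trivial
    | succ m =>
      have hstep : S.Poly i m (1 + i + i) (fun n => ⁅y⁻¹ ^ n, ⁅x⁻¹, y⁻¹⁆⁆ * ⁅x⁻¹, y⁻¹⁆) :=
        ((Poly.closure i m).1 _ _ _ ((Poly.closure i m).2.2 _ _ _ _ (pow0 m (inv_mem hy))
          (Poly.const hc)) (Poly.const (by simpa using hc))).mono (by omega)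
      refine ⟨fun n => ?_, ?_⟩
      · cases n with
        | zero => simp
        | succ n =>
          exact S.antitone (by omega) (hab i i _ (inv_mem hx) _ (pow_mem (inv_mem hy) (n + 1)))
      · convert hstep using 2 with n
        simp only [commutatorElement_def, pow_succ]; group
  have hxy := mul_mem hx hy
  have key : ∀ m, S.Poly i m 1 (fun n => (y ^ n)⁻¹ * (x ^ n)⁻¹ * (x * y) ^ n) := by
    intro m
    induction m with
    | zero => trivial
    | succ m ih =>
      refine ⟨fun n => by rw [S.term_one]; trivial, ?_⟩
      obtain ⟨mulP, invP, comP⟩ := Poly.closure (S := S) i m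
      -- with `h = y⁻ⁿ x⁻ⁿ (x y)ⁿ`, `w = (x y)⁻¹` and `d = ⁅x⁻¹, y⁻ⁿ⁆⁻¹`, the difference of the
      -- sequence is the conjugate of `d` by `h⁻¹ y⁻¹`, times `⁅h⁻¹, w⁆`
      have h0 := invP _ _ ih
      have h1 := comP _ _ _ _ h0 (Poly.const (inv_mem hxy))
      have c1 := invP _ _ (com1 m)
      have c2 := mulP _ _ _ ((comP _ _ _ _ (Poly.const (m := m) (inv_mem hy)) c1).mono
        (Nat.le_add_left (1 + i) i)) c1
      have c3 := mulP _ _ _ ((comP _ _ _ _ h0 c2).mono (by omega)) c2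
      have c4 := mulP _ _ _ c3 h1
      convert c4 using 2 with n
      simp only [commutatorElement_def, pow_succ]; group
  have := (key (p + 1)).prime_mem (by simp)
  simpa using this

theorem powFun_add (hab : IsLieAbelian S.LieAlg) {i : ℕ} (x y : S.Factor i) :
    S.powFun i (x + y) = S.powFun i x + S.powFun i y := by
  obtain ⟨a, rfl⟩ := cls_surj x
  obtain ⟨b, rfl⟩ := cls_surj y
  rw [← cls_mul, powFun_cls, powFun_cls, powFun_cls, ← cls_mul, eq_comm, cls_eq_cls]
  simpa [mul_assoc] using S.mul_pow_mem_of_isLieAbelian hab a.2 b.2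

end PSeries

namespace PSeries

/-! ### The `p`-map of an abelian Lie algebra -/

variable {p : ℕ} {H : Type*} [Group H] (S : PSeries p H) [hp : Fact p.Prime]

/-- The `p`-map of an abelian `L_p(H, Hᵢ)` as a linear map: it is additive, and over the prime
field additive maps are linear. -/
noncomputable def pLin (hab : IsLieAbelian S.LieAlg) : Module.End (ZMod p) S.LieAlg :=
  (S.liftHom fun i =>
    (S.of (p * i)).comp (AddMonoidHom.mk' (S.powFun i) (S.powFun_add hab))).toZModLinearMap p

variable {S}

theorem powFun_zero (hab : IsLieAbelian S.LieAlg) (i : ℕ) : S.powFun i 0 = 0 :=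
  (AddMonoidHom.mk' (S.powFun i) (S.powFun_add hab)).map_zero

theorem pLin_of (hab : IsLieAbelian S.LieAlg) (i : ℕ) (x : S.Factor i) :
    S.pLin hab (S.of i x) = S.of (p * i) (S.powFun i x) :=
  S.liftHom_of _ i x

theorem component_mul_pLin (hab : IsLieAbelian S.LieAlg) (i : ℕ) (x : S.LieAlg) :
    S.component (p * i) (S.pLin hab x) = S.powFun i (S.component i x) := by
  let P := AddMonoidHom.mk' (S.powFun i) (S.powFun_add hab)
  suffices h : (S.component (p * i)).comp (S.pLin hab).toAddMonoidHom = P.comp (S.component i) from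
    DFunLike.congr_fun h x
  refine S.hom_ext fun j a => ?_
  change S.component (p * i) (S.pLin hab (S.of j (S.cls j a))) =
    S.powFun i (S.component i (S.of j (S.cls j a)))
  rw [pLin_of]
  by_cases h : j = i
  · subst h
    rw [component_of_same, component_of_same]
  · rw [S.component_of_ne h, powFun_zero hab, component_of_ne]
    exact fun h' => h (Nat.eq_of_mul_eq_mul_left hp.out.pos h')

theorem component_pLin_of_not_dvd (hab : IsLieAbelian S.LieAlg) {m : ℕ} (hm : ¬ p ∣ m)
    (x : S.LieAlg) :
    S.component m (S.pLin hab x) = 0 := by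
  suffices h : (S.component m).comp (S.pLin hab).toAddMonoidHom = 0 from DFunLike.congr_fun h x
  refine S.hom_ext fun j a => ?_
  change S.component m (S.pLin hab (S.of j (S.cls j a))) = 0
  rw [pLin_of, component_of_ne]
  rintro rfl
  exact hm (dvd_mul_right p j)

theorem jacobsonPoly_eq_zero (hab : IsLieAbelian S.LieAlg) (x y : S.LieAlg) :
    jacobsonPoly p x y = 0 := by
  refine Finset.sum_eq_zero fun c _ => ?_
  obtain ⟨q, hq⟩ : ∃ q, p - 1 = q + 1 := ⟨p - 2, by have := hp.out.two_le; omega⟩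
  have : ∃ e l, List.ofFn c = e :: l := by
    cases h : List.ofFn c with
    | nil =>
      have := congrArg List.length h
      simp at this
      omega
    | cons e l => exact ⟨e, l, rfl⟩
  obtain ⟨e, l, he⟩ := this
  rw [he, List.foldr_cons, trivial_lie_zero, smul_zero]

theorem pMap_eq_pLin (hab : IsLieAbelian S.LieAlg) : S.pMap = S.pLin hab := by
  funext x
  have h1 : ∀ n, S.pMapBelow x n =
      S.pLin hab (∑ i ∈ Finset.range n, S.of i (S.component i x)) := by
    intro n
    induction n with
    | zero => simp [pMapBelow]
    | succ n ih =>
      rw [pMapBelow, ih, jacobsonPoly_eq_zero hab, add_zero, Finset.sum_range_succ,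
        map_add, pLin_of]
  have h2 : ∀ i, sInf {n | ∀ i, n ≤ i → S.component i x = 0} ≤ i → S.component i x = 0 :=
    Nat.sInf_mem (S.exists_bound x)
  rw [pMap, h1, S.sum_range_of_component h2]

theorem pMap_iterate (hab : IsLieAbelian S.LieAlg) (k : ℕ) (x : S.LieAlg) :
    S.pMap^[k] x = (S.pLin hab ^ k) x := by
  rw [pMap_eq_pLin hab, Module.End.pow_apply]

end PSeries

namespace PSeries

/-! ### Finite rank in terms of the factors -/

variable {p : ℕ} {H : Type*} [Group H] {S : PSeries p H} [hp : Fact p.Prime]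

variable (S) in
/-- From degree `N` on, the `p`-th power induces bijections `Hₙ / Hₙ₊₁ → Hₚₙ / Hₚₙ₊₁`, and the
remaining factors of degree at least `p * N` are trivial. -/
structure PowBijectiveFrom (N : ℕ) : Prop where
  inj : ∀ n, N ≤ n → Function.Injective (S.powFun n)
  surj : ∀ n, N ≤ n → Function.Surjective (S.powFun n)
  term_le : ∀ m, p * N ≤ m → ¬ p ∣ m → S.term m ≤ S.term (m + 1)

theorem powFun_injective_of_forall_eq_zero (hab : IsLieAbelian S.LieAlg) {n : ℕ}
    (h : ∀ x, S.powFun n x = 0 → x = 0) : Function.Injective (S.powFun n) :=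
  (injective_iff_map_eq_zero (AddMonoidHom.mk' (S.powFun n) (S.powFun_add hab))).2 h

/-- On a free abelian restricted Lie algebra the `p`-map is injective, since it maps the basis
injectively into itself. -/
theorem IsFreeAbelianOn.eq_zero_of_pLin_eq_zero (hab : IsLieAbelian S.LieAlg)
    {T : LieSubalgebra (ZMod p) S.LieAlg} {r : ℕ} (hT : S.IsFreeAbelianOn T r)
    {y : S.LieAlg} (hy : y ∈ T) (h0 : S.pLin hab y = 0) : y = 0 := by
  obtain ⟨-, x, hli, hspan⟩ := hT
  set v := fun jk : Fin r × ℕ => S.pMap^[jk.2] (x jk.1) with hv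
  have hy' : y ∈ Submodule.span (ZMod p) (Set.range v) := by rw [hspan]; exact hy
  rw [Finsupp.mem_span_range_iff_exists_finsupp] at hy'
  obtain ⟨l, rfl⟩ := hy'
  let f : Fin r × ℕ → Fin r × ℕ := fun jk => (jk.1, jk.2 + 1)
  have hf : Function.Injective f := by
    rintro ⟨a, b⟩ ⟨c, d⟩ h
    simpa [f] using h
  have hvf : ∀ jk, S.pLin hab (v jk) = v (f jk) := by
    intro jk
    simp only [hv, f]
    rw [Function.iterate_succ_apply', pMap_eq_pLin hab]
  have h1 : Finsupp.linearCombination (ZMod p) v (Finsupp.mapDomain f l) = 0 := by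
    rw [Finsupp.linearCombination_mapDomain, ← h0, map_finsuppSum, Finsupp.linearCombination_apply]
    simp [hvf]
  have h2 := (linearIndependent_iff.1 hli) _ h1
  rw [Finsupp.mapDomain_injective hf (h2.trans Finsupp.mapDomain_zero.symm)]
  simp

theorem IsFreeAbelianOfRank.isAbelianOfRank {r : ℕ} (h : S.IsFreeAbelianOfRank r) :
    S.IsAbelianOfRank r := by
  have hab : IsLieAbelian S.LieAlg := by
    obtain ⟨h1, -⟩ := h
    refine ⟨fun x y => ?_⟩
    have := h1.trivial ⟨x, LieSubalgebra.mem_top x⟩ ⟨y, LieSubalgebra.mem_top y⟩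
    exact congrArg Subtype.val this
  refine ⟨hab, ⊤, ⊥, fun x _ => LieSubalgebra.mem_top _, ?_, ?_, h, ?_⟩
  · intro x hx
    rw [LieSubalgebra.mem_bot] at hx
    rw [hx, pMap_eq_pLin hab, map_zero]
    exact zero_mem _
  · simpa using isCompl_top_bot
  · simp

/-- An abelian `L_p(H, Hᵢ)` of finite rank is the sum of a finite subspace `V` and the image of the
`p`-map, whose kernel is finite. Beyond the degrees that occur in `V` and in the kernel the `p`-map
is therefore bijective. -/
theorem IsAbelianOfRank.exists_powBijectiveFrom {r : ℕ} (h : S.IsAbelianOfRank r) :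
    (∀ i, Finite (S.Factor i)) ∧ ∃ N, S.PowBijectiveFrom N := by
  obtain ⟨hab, T, T₀, hT, hT₀, hcompl, hfree, hfin⟩ := h
  have hker : ∀ y, S.pLin hab y = 0 → y ∈ T₀ := by
    intro y hy
    have hy' : y ∈ T.toSubmodule ⊔ T₀.toSubmodule := by rw [hcompl.sup_eq_top]; trivial
    obtain ⟨u, hu, v, hv, rfl⟩ := Submodule.mem_sup.1 hy'
    rw [map_add] at hy
    have h1 : S.pLin hab u ∈ T := by rw [← pMap_eq_pLin hab]; exact hT u hu
    have h2 : S.pLin hab u ∈ T₀ := by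
      rw [eq_neg_of_add_eq_zero_left hy]
      refine neg_mem ?_
      rw [← pMap_eq_pLin hab]; exact hT₀ v hv
    have h3 : S.pLin hab u = 0 := Submodule.disjoint_def.1 hcompl.disjoint _ h1 h2
    rw [hfree.eq_zero_of_pLin_eq_zero hab hu h3, zero_add]
    exact hv
  obtain ⟨-, x, -, hspan⟩ := hfree
  set V : Submodule (ZMod p) S.LieAlg :=
    Submodule.span (ZMod p) (Set.range x) ⊔ T₀.toSubmodule with hV
  have hVfin : Finite V := by
    have : Finite T₀.toSubmodule := hfin
    have : Module.Finite (ZMod p) T₀.toSubmodule := Module.Finite.of_finite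
    have : Module.Finite (ZMod p) (Submodule.span (ZMod p) (Set.range x)) :=
      Module.Finite.span_of_finite _ (Set.finite_range x)
    exact Module.finite_of_finite (ZMod p)
  -- every element is a `p`-th power modulo the finite space `V`
  have hdecomp : ∀ y, ∃ s ∈ V, ∃ z, y = s + S.pLin hab z := by
    intro y
    have hle : (⊤ : Submodule (ZMod p) S.LieAlg) ≤ V ⊔ LinearMap.range (S.pLin hab) := by
      rw [← hcompl.sup_eq_top, ← hspan]
      refine sup_le (Submodule.span_le.2 ?_) (le_sup_right.trans le_sup_left)
      rintro _ ⟨⟨j, k⟩, rfl⟩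
      cases k with
      | zero =>
        exact (le_sup_left.trans le_sup_left : Submodule.span (ZMod p) (Set.range x) ≤ _)
          (Submodule.subset_span ⟨j, rfl⟩)
      | succ k =>
        refine (le_sup_right : LinearMap.range (S.pLin hab) ≤ _) ⟨S.pMap^[k] (x j), ?_⟩
        simp only [Function.iterate_succ_apply', pMap_eq_pLin hab]
    obtain ⟨s, hs, _, ⟨z, rfl⟩, h⟩ := Submodule.mem_sup.1 (hle (x := y) trivial)
    exact ⟨s, hs, z, h.symm⟩
  obtain ⟨N, hN⟩ := S.exists_bound_of_finite (s := (V : Set S.LieAlg)) hVfin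
  refine ⟨?_, N, ?_, ?_, ?_⟩
  -- `Hₘ / Hₘ₊₁` is covered by the image of `V` and, if `p ∣ m`, the `p`-th powers of the factor of
  -- degree `m / p`
  · intro m
    induction m using Nat.strong_induction_on with
    | _ m ih =>
      by_cases hm : p ∣ m
      · obtain ⟨n, rfl⟩ := hm
        rcases Nat.eq_zero_or_pos n with rfl | hn
        · rw [mul_zero]; infer_instance
        · have := ih n (by nlinarith [hp.out.two_le])
          refine Finite.of_surjective (fun sz : V × S.Factor n =>
            S.component (p * n) sz.1 + S.powFun n sz.2) fun y => ?_
          obtain ⟨s, hs, z, h⟩ := hdecomp (S.of _ y)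
          refine ⟨(⟨s, hs⟩, S.component n z), ?_⟩
          have := congrArg (S.component (p * n)) h
          rw [component_of_same, map_add, component_mul_pLin] at this
          exact this.symm
      · refine Finite.of_surjective (fun s : V => S.component m s) fun y => ?_
        obtain ⟨s, hs, z, h⟩ := hdecomp (S.of _ y)
        refine ⟨⟨s, hs⟩, ?_⟩
        have := congrArg (S.component m) h
        rw [component_of_same, map_add, component_pLin_of_not_dvd hab hm, add_zero] at this
        exact this.symm
  · intro n hn
    refine powFun_injective_of_forall_eq_zero hab fun y hy => ?_
    have h1 : S.of n y ∈ T₀ := hker _ (by rw [pLin_of, hy, map_zero])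
    have h2 := hN _ ((le_sup_right : T₀.toSubmodule ≤ V) h1) n hn
    rwa [component_of_same] at h2
  · intro n hn y
    obtain ⟨s, hs, z, h⟩ := hdecomp (S.of _ y)
    refine ⟨S.component n z, ?_⟩
    have := congrArg (S.component (p * n)) h
    rw [component_of_same, map_add, component_mul_pLin,
      hN s hs _ (hn.trans (Nat.le_mul_of_pos_left n hp.out.pos)), zero_add] at this
    exact this.symm
  · intro m hm hpm a ha
    obtain ⟨s, hs, z, h⟩ := hdecomp (S.of m (S.cls m ⟨a, ha⟩))
    have := congrArg (S.component m) h
    rw [component_of_same, map_add, component_pLin_of_not_dvd hab hpm,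
      hN s hs _ ((Nat.le_mul_of_pos_left N hp.out.pos).trans hm), zero_add] at this
    exact S.cls_eq_zero.1 this

theorem IsFreeAbelianOfRank.powFun_injective {r : ℕ} (h : S.IsFreeAbelianOfRank r) (n : ℕ) :
    Function.Injective (S.powFun n) := by
  have hab := h.isAbelianOfRank.1
  refine powFun_injective_of_forall_eq_zero hab fun y hy => ?_
  have h1 := h.eq_zero_of_pLin_eq_zero hab (LieSubalgebra.mem_top (S.of n y))
    (by rw [pLin_of, hy, map_zero])
  rw [← S.component_of_same n y, h1, map_zero]

/-- With the `p`-map as the action of the variable, `L_p(H, Hᵢ)` is a finitely generated module over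
the polynomial ring. -/
theorem PowBijectiveFrom.module_finite {N : ℕ} (hab : IsLieAbelian S.LieAlg)
    (hfin : ∀ i, Finite (S.Factor i)) (hN : S.PowBijectiveFrom N) :
    Module.Finite (Polynomial (ZMod p)) (Module.AEval' (S.pLin hab)) := by
  let e := Module.AEval'.of (S.pLin hab)
  -- the homogeneous elements of degree at most `p * N` generate: above, the factor is
  -- trivial or consists of `p`-th powers
  let g : (Σ i : Fin (p * N + 1), S.Factor i) → Module.AEval' (S.pLin hab) :=
    fun y => e (S.of y.1 y.2)
  have key : ∀ m (y : S.Factor m),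
      e (S.of m y) ∈ Submodule.span (Polynomial (ZMod p)) (Set.range g) := by
    intro m
    induction m using Nat.strong_induction_on with
    | _ m ih =>
      intro y
      by_cases hm : m < p * N + 1
      · exact Submodule.subset_span ⟨⟨⟨m, hm⟩, y⟩, rfl⟩
      by_cases hpm : p ∣ m
      · obtain ⟨n, rfl⟩ := hpm
        have hn : N ≤ n := le_of_lt (Nat.lt_of_mul_lt_mul_left (a := p) (by omega))
        obtain ⟨z, rfl⟩ := hN.surj n hn y
        have hn0 : n ≠ 0 := by rintro rfl; simp at hm
        have h1 := ih n (by nlinarith [hp.out.two_le, Nat.pos_of_ne_zero hn0]) z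
        rw [← pLin_of hab, ← Module.AEval'.X_smul_of]
        exact Submodule.smul_mem _ _ h1
      · obtain ⟨a, rfl⟩ := cls_surj y
        rw [S.cls_eq_zero.2 (hN.term_le m (by omega) hpm a.2), map_zero, map_zero]
        exact zero_mem _
  refine ⟨⟨(Set.finite_range g).toFinset, ?_⟩⟩
  rw [Set.Finite.coe_toFinset, eq_top_iff]
  intro y _
  obtain ⟨y, rfl⟩ := e.surjective y
  obtain ⟨n, hn⟩ := S.exists_bound y
  rw [← S.sum_range_of_component hn, map_sum]
  exact Submodule.sum_mem _ fun i _ => key i _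

/-- Torsion elements, with respect to the action of the `p`-map, live in the degrees in which the
`p`-map is not injective. -/
theorem component_eq_zero_of_aeval_eq_zero (hab : IsLieAbelian S.LieAlg) {N : ℕ}
    (hN : ∀ n, N ≤ n → Function.Injective (S.powFun n)) {y : S.LieAlg}
    {q : Polynomial (ZMod p)} (hq : q ≠ 0) (hy : Polynomial.aeval (S.pLin hab) q y = 0)
    {m : ℕ} (hm : N ≤ m) : S.component m y = 0 := by
  by_contra hne
  -- the iterated `p`-th powers of `y` lie in the span of finitely many of them
  obtain ⟨B, hB⟩ := S.exists_bound_of_finite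
    (Set.finite_range fun i : Fin (q.natDegree + 1) => (S.pLin hab ^ (i : ℕ)) y)
  have hbound : ∀ k i, B ≤ i → S.component i ((S.pLin hab ^ k) y) = 0 := by
    intro k i hi
    have h1 : (S.pLin hab ^ k) y =
        Polynomial.aeval (S.pLin hab) ((Polynomial.X ^ k : Polynomial (ZMod p)) % q) y := by
      have h2 := congrArg (fun f => Polynomial.aeval (S.pLin hab) f y)
        (EuclideanDomain.mod_add_div (Polynomial.X ^ k : Polynomial (ZMod p)) q)
      simp only [map_add, LinearMap.add_apply, mul_comm q, map_mul, Module.End.mul_apply, hy,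
        map_zero, add_zero, map_pow, Polynomial.aeval_X] at h2
      exact h2.symm
    have hdeg : ((Polynomial.X ^ k : Polynomial (ZMod p)) % q).natDegree < q.natDegree + 1 :=
      Nat.lt_succ_of_le (Polynomial.natDegree_le_natDegree (EuclideanDomain.mod_lt _ hq).le)
    rw [h1, Polynomial.aeval_eq_sum_range' hdeg, LinearMap.sum_apply, map_sum]
    refine Finset.sum_eq_zero fun j hj => ?_
    rw [LinearMap.smul_apply, ZMod.map_smul, hB _ ⟨⟨j, Finset.mem_range.1 hj⟩, rfl⟩ i hi, smul_zero]
  -- but the degree of the highest component multiplies by `p` under the `p`-map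
  have hgrow : ∀ k, ∃ i, N ≤ i ∧ k ≤ i ∧ S.component i ((S.pLin hab ^ k) y) ≠ 0 := by
    intro k
    induction k with
    | zero => exact ⟨m, hm, m.zero_le, hne⟩
    | succ k ih =>
      obtain ⟨i, hi, hki, h⟩ := ih
      have hi0 : 0 < i := by
        rcases Nat.eq_zero_or_pos i with rfl | h0
        · exact absurd (Subsingleton.elim _ _) h
        · exact h0
      have hp2 : 2 * i ≤ p * i := Nat.mul_le_mul_right i hp.out.two_le
      refine ⟨p * i, by omega, by omega, ?_⟩
      rw [pow_succ', Module.End.mul_apply, component_mul_pLin, ← powFun_zero hab]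
      exact fun h' => h (hN i hi h')
  obtain ⟨i, -, hi, h⟩ := hgrow B
  exact h (hbound B i hi)

theorem PowBijectiveFrom.exists_decomposition {N : ℕ} (hab : IsLieAbelian S.LieAlg)
    (hfin : ∀ i, Finite (S.Factor i)) (hN : S.PowBijectiveFrom N) :
    ∃ r, ∃ T T₀ : LieSubalgebra (ZMod p) S.LieAlg,
      (∀ x ∈ T, S.pMap x ∈ T) ∧ (∀ x ∈ T₀, S.pMap x ∈ T₀) ∧
      IsCompl T.toSubmodule T₀.toSubmodule ∧ S.IsFreeAbelianOn T r ∧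
      ∀ x ∈ T₀, ∃ q : Polynomial (ZMod p), q ≠ 0 ∧ Polynomial.aeval (S.pLin hab) q x = 0 := by
  have := hN.module_finite hab hfin
  obtain ⟨r, x, T₀, h1, h2, h3, h4⟩ := exists_free_isCompl_torsion (S.pLin hab)
  simp_rw [← pMap_iterate hab] at h3 h4
  refine ⟨r, ⟨_, fun {x y} _ _ => ?_⟩, ⟨T₀, fun {x y} _ _ => ?_⟩, ?_, ?_, h4, ⟨?_, x, h3, rfl⟩, h2⟩
  · rw [trivial_lie_zero]; exact Submodule.zero_mem _
  · rw [trivial_lie_zero]; exact Submodule.zero_mem _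
  · intro y hy
    refine Submodule.span_induction (p := fun y _ => S.pMap y ∈ Submodule.span _ _) ?_ ?_ ?_ ?_ hy
    · rintro _ ⟨⟨j, k⟩, rfl⟩
      exact Submodule.subset_span ⟨⟨j, k + 1⟩, by simp only [Function.iterate_succ_apply']⟩
    · rw [pMap_eq_pLin hab, map_zero]; exact Submodule.zero_mem _
    · intro a b _ _ ha hb
      rw [pMap_eq_pLin hab] at *
      rw [map_add]; exact Submodule.add_mem _ ha hb
    · intro c a _ ha
      rw [pMap_eq_pLin hab] at *
      rw [map_smul]; exact Submodule.smul_mem _ _ ha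
  · intro y hy
    rw [pMap_eq_pLin hab]
    exact h1 y hy
  · exact ⟨fun a b => Subtype.ext (trivial_lie_zero _ _ _ _)⟩

theorem PowBijectiveFrom.exists_isAbelianOfRank {N : ℕ} (hab : IsLieAbelian S.LieAlg)
    (hfin : ∀ i, Finite (S.Factor i)) (hN : S.PowBijectiveFrom N) : ∃ r, S.IsAbelianOfRank r := by
  obtain ⟨r, T, T₀, h1, h2, h3, h4, h5⟩ := hN.exists_decomposition hab hfin
  refine ⟨r, hab, T, T₀, h1, h2, h3, h4, ?_⟩
  refine Set.Finite.subset (Set.finite_range fun y : ∀ i : Fin N, S.Factor i =>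
    ∑ i : Fin N, S.of i (y i)) fun y hy => ⟨fun i => S.component i y, ?_⟩
  obtain ⟨q, hq, hqy⟩ := h5 y hy
  have h6 := S.sum_range_of_component (x := y) (n := N)
    fun i hi => component_eq_zero_of_aeval_eq_zero hab hN.inj hq hqy hi
  rw [Finset.sum_range] at h6
  exact h6

theorem PowBijectiveFrom.exists_isFreeAbelianOfRank {N : ℕ} (hab : IsLieAbelian S.LieAlg)
    (hfin : ∀ i, Finite (S.Factor i)) (hN : S.PowBijectiveFrom N)
    (hinj : ∀ n, Function.Injective (S.powFun n)) : ∃ r, S.IsFreeAbelianOfRank r := by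
  obtain ⟨r, T, T₀, h1, h2, h3, h4, h5⟩ := hN.exists_decomposition hab hfin
  have h0 : T₀.toSubmodule = ⊥ := by
    rw [Submodule.eq_bot_iff]
    intro y hy
    obtain ⟨q, hq, hqy⟩ := h5 y hy
    refine S.lieAlg_ext fun i => ?_
    rw [map_zero]
    exact component_eq_zero_of_aeval_eq_zero hab (N := 0) (fun n _ => hinj n) hq hqy i.zero_le
  have hT : T = ⊤ := by
    rw [← LieSubalgebra.toSubmodule_inj, LieSubalgebra.top_toSubmodule, ← h3.sup_eq_top, h0,
      sup_bot_eq]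
  subst hT
  exact ⟨r, h4⟩

end PSeries

/-! ### Indices and dimension subgroups -/

/-- A map of sets `A → B` that induces an injection on cosets bounds the index; the hypothesis only
asks that distinct cosets be separated, not that the map on cosets be well defined. -/
theorem Subgroup.relIndex_le_of_forall_inv_mul_mem {G : Type*} [Group G] {A A' B B' : Subgroup G}
    (f : G → G) (hf : ∀ x ∈ A, f x ∈ B)
    (h : ∀ x ∈ A, ∀ y ∈ A, (f x)⁻¹ * f y ∈ B' → x⁻¹ * y ∈ A') (hB : B'.relIndex B ≠ 0) :
    A'.relIndex A ≤ B'.relIndex B := by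
  have : Finite (B ⧸ B'.subgroupOf B) := Nat.finite_of_card_ne_zero hB
  refine Nat.card_le_card_of_injective (fun x : A ⧸ A'.subgroupOf A =>
    (QuotientGroup.mk (⟨f x.out, hf _ x.out.2⟩ : B) : B ⧸ B'.subgroupOf B)) fun x y hxy => ?_
  rw [← x.out_eq', ← y.out_eq', QuotientGroup.eq, Subgroup.mem_subgroupOf]
  rw [QuotientGroup.eq, Subgroup.mem_subgroupOf] at hxy
  exact h _ x.out.2 _ y.out.2 hxy

theorem map_mem_dimensionSubgroup {p : ℕ} {H K : Type*} [Group H] [Group K] (φ : H →* K) {n : ℕ}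
    {h : H} (hh : h ∈ dimensionSubgroup p H n) : φ h ∈ dimensionSubgroup p K n := by
  let Φ : MonoidAlgebra (ZMod p) H →ₐ[ZMod p] MonoidAlgebra (ZMod p) K :=
    MonoidAlgebra.mapDomainAlgHom (ZMod p) (ZMod p) φ
  have hΦ : ∀ x, Φ (MonoidAlgebra.of (ZMod p) H x) = MonoidAlgebra.of (ZMod p) K (φ x) := by
    intro x
    simp [Φ]
  have h1 : ∀ x ∈ augmentationIdeal p H, Φ x ∈ augmentationIdeal p K := by
    intro x hx
    have h2 : (MonoidAlgebra.lift (ZMod p) (ZMod p) K (1 : K →* ZMod p)).comp Φ =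
        MonoidAlgebra.lift (ZMod p) (ZMod p) H (1 : H →* ZMod p) :=
      MonoidAlgebra.algHom_ext' (MonoidHom.ext fun x => by simp [Φ]) (Subsingleton.elim _ _)
    have h3 := DFunLike.congr_fun h2 x
    exact h3.trans hx
  have h2 : ∀ n, augmentationIdeal p H ^ n ≤
      Ideal.comap Φ.toRingHom (augmentationIdeal p K ^ n) := by
    intro n
    induction n with
    | zero => rw [Submodule.pow_zero, Submodule.pow_zero, Ideal.one_eq_top, Ideal.one_eq_top,
        Ideal.comap_top]
    | succ n ih =>
      rw [Submodule.pow_succ, Submodule.pow_succ, Ideal.mul_le]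
      intro r hr s hs
      rw [Ideal.mem_comap, map_mul]
      exact Ideal.mul_mem_mul (ih hr) (h1 s hs)
  have h3 : Φ (MonoidAlgebra.of (ZMod p) H h - 1) ∈ augmentationIdeal p K ^ n := h2 n hh
  have h4 : Φ (MonoidAlgebra.of (ZMod p) H h - 1) = MonoidAlgebra.of (ZMod p) K (φ h) - 1 := by
    rw [map_sub, hΦ, map_one]
  rw [h4] at h3
  exact h3

namespace PSeries

/-! ### The characteristic core -/

variable {p : ℕ} {H : Type*} [Group H] (S : PSeries p H)

/-- The characteristic core of a `p`-series: its `i`-th term consists of the elements all of whose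
images under automorphisms of `H` lie in the `i`-th term of the series. -/
def charCore : PSeries p H where
  term i := ⨅ φ : H ≃* H, (S.term i).comap φ.toMonoidHom
  term_zero := by simp [S.term_zero]
  term_one := by simp [S.term_one]
  antitone _ _ hij := iInf_mono fun _ => Subgroup.comap_mono (S.antitone hij)
  normal i := Subgroup.normal_iInf_normal fun φ => (S.normal i).comap _
  commutator_le i j := by
    refine Subgroup.commutator_le.2 fun a ha b hb => ?_
    simp only [Subgroup.mem_iInf, Subgroup.mem_comap] at *
    intro φ
    rw [map_commutatorElement]
    exact comm_mem (ha φ) (hb φ)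
  power_mem i h hh := by
    simp only [Subgroup.mem_iInf, Subgroup.mem_comap] at *
    intro φ
    rw [map_pow]
    exact S.power_mem i _ (hh φ)

variable {S}

theorem mem_charCore {i : ℕ} {h : H} : h ∈ S.charCore.term i ↔ ∀ φ : H ≃* H, φ h ∈ S.term i := by
  simp [charCore, Subgroup.mem_iInf]

theorem charCore_le (i : ℕ) : S.charCore.term i ≤ S.term i :=
  fun _ hh => mem_charCore.1 hh (MulEquiv.refl H)

theorem charCore_characteristic (i : ℕ) : (S.charCore.term i).Characteristic := by
  refine Subgroup.characteristic_iff_le_comap.2 fun φ h hh => ?_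
  rw [Subgroup.mem_comap, mem_charCore]
  exact fun ψ => mem_charCore.1 hh (φ.trans ψ)

theorem charCore_isLieAbelian (hab : IsLieAbelian S.LieAlg) : IsLieAbelian S.charCore.LieAlg := by
  rw [isLieAbelian_iff] at *
  intro i j a ha b hb
  rw [mem_charCore] at *
  intro φ
  rw [map_commutatorElement]
  exact hab i j _ (ha φ) _ (hb φ)

/-- The dimension subgroups are characteristic, so a term of the series that contains one of them
contains all its images under automorphisms; this is where the topology enters. -/
theorem exists_term_le_charCore (htop : S.topology = pTopology p H) (i : ℕ) :
    ∃ N, S.term N ≤ S.charCore.term i := by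
  have h1 : @IsOpen H S.topology (S.term i : Set H) := fun x hx => ⟨i, fun h hh => mul_mem hx hh⟩
  rw [htop] at h1
  obtain ⟨n, hn⟩ := h1 1 (one_mem _)
  have h2 : @IsOpen H (pTopology p H) (dimensionSubgroup p H n : Set H) :=
    fun x hx => ⟨n, fun h hh => mul_mem hx hh⟩
  rw [← htop] at h2
  obtain ⟨N, hN⟩ := h2 1 (one_mem _)
  refine ⟨N, fun h hh => mem_charCore.2 fun φ => ?_⟩
  have h3 := map_mem_dimensionSubgroup φ.toMonoidHom (p := p) (n := n) (h := h)
    (by simpa using hN h hh)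
  simpa using hn _ h3

/-! ### Boundedness of indices -/

theorem card_factor (i : ℕ) : Nat.card (S.Factor i) = (S.term (i + 1)).relIndex (S.term i) := rfl

theorem index_term_ne_zero (hfin : ∀ i, Finite (S.Factor i)) (i : ℕ) : (S.term i).index ≠ 0 := by
  induction i with
  | zero => simp [S.term_zero]
  | succ i ih =>
    rw [← Subgroup.relIndex_mul_index (S.antitone (Nat.le_succ i)), ← card_factor]
    exact mul_ne_zero (Nat.card_pos (α := S.Factor i)).ne' ih

theorem finite_factor_of_index_ne_zero (hfin : ∀ i, (S.term i).index ≠ 0) (i : ℕ) :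
    Finite (S.Factor i) := by
  refine Nat.finite_of_card_ne_zero fun h => ?_
  rw [card_factor] at h
  exact hfin _ (Subgroup.index_eq_zero_of_relIndex_eq_zero h)

variable [hp : Fact p.Prime]

theorem powFun_injective_iff {n : ℕ} : Function.Injective (S.powFun n) ↔
    ∀ x ∈ S.term n, ∀ y ∈ S.term n, (x ^ p)⁻¹ * y ^ p ∈ S.term (p * n + 1) →
      x⁻¹ * y ∈ S.term (n + 1) := by
  constructor
  · intro h x hx y hy hxy
    refine (S.cls_eq_cls (a := ⟨x, hx⟩) (b := ⟨y, hy⟩)).1 (h ?_)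
    rw [powFun_cls, powFun_cls, cls_eq_cls]
    exact hxy
  · intro h x y hxy
    obtain ⟨a, rfl⟩ := cls_surj x
    obtain ⟨b, rfl⟩ := cls_surj y
    rw [powFun_cls, powFun_cls, cls_eq_cls] at hxy
    rw [cls_eq_cls]
    exact h a a.2 b b.2 hxy

theorem charCore_powFun_injective {n : ℕ} (h : Function.Injective (S.powFun n)) :
    Function.Injective (S.charCore.powFun n) := by
  rw [powFun_injective_iff] at *
  intro x hx y hy hxy
  rw [mem_charCore] at *
  intro φ
  simpa using h _ (hx φ) _ (hy φ) (by simpa using hxy φ)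

theorem term_mul_add_le {N : ℕ} (h : ∀ m, p * N ≤ m → ¬ p ∣ m → S.term m ≤ S.term (m + 1))
    {n : ℕ} (hn : N ≤ n) : S.term (p * n + 1) ≤ S.term (p * (n + 1)) := by
  have key : ∀ j, 1 ≤ j → j ≤ p → S.term (p * n + 1) ≤ S.term (p * n + j) := by
    intro j hj
    induction j, hj using Nat.le_induction with
    | base => exact fun _ => le_rfl
    | succ j hj ih =>
      intro hjp
      refine (ih (by omega)).trans (h _ ?_ ?_)
      · have := Nat.mul_le_mul_left p hn
        omega
      · rw [Nat.dvd_add_right (dvd_mul_right p n)]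
        exact Nat.not_dvd_of_pos_of_lt hj hjp
  exact key p hp.out.one_le le_rfl

/-- Going from `n` to `n + 1`, the index of `Hₚₙ` in `Hₙ` gains the orders of the factors between
`Hₚₙ` and `Hₚₙ₊ₚ` and loses the order of `Hₙ / Hₙ₊₁`. -/
theorem card_factor_mul_relIndex (n : ℕ) :
    Nat.card (S.Factor n) * (S.term (p * (n + 1))).relIndex (S.term (n + 1)) =
      (S.term (p * n)).relIndex (S.term n) * (Nat.card (S.Factor (p * n)) *
        (S.term (p * (n + 1))).relIndex (S.term (p * n + 1))) := by
  have hp2 := hp.out.two_le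
  have a1 := S.antitone (Nat.le_succ n)
  have a2 : S.term (p * (n + 1)) ≤ S.term (n + 1) :=
    S.antitone (Nat.le_mul_of_pos_left _ hp.out.pos)
  have a3 : S.term (p * n) ≤ S.term n := S.antitone (Nat.le_mul_of_pos_left _ hp.out.pos)
  have a4 : S.term (p * n + 1) ≤ S.term (p * n) := S.antitone (Nat.le_succ _)
  have a5 : S.term (p * (n + 1)) ≤ S.term (p * n + 1) := S.antitone (by rw [mul_add]; omega)
  rw [card_factor, card_factor, mul_comm, Subgroup.relIndex_mul_relIndex _ _ _ a2 a1,
    mul_comm (Subgroup.relIndex _ (S.term (p * n))), Subgroup.relIndex_mul_relIndex _ _ _ a5 a4,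
    mul_comm (Subgroup.relIndex _ (S.term n)),
    Subgroup.relIndex_mul_relIndex _ _ _ (a5.trans a4) a3]

theorem PowBijectiveFrom.relIndex_le {N : ℕ} (hfin : ∀ i, Finite (S.Factor i))
    (hN : S.PowBijectiveFrom N) {n : ℕ} (hn : N ≤ n) :
    (S.term (p * n)).relIndex (S.term n) ≤ (S.term (p * N)).relIndex (S.term N) := by
  induction n, hn using Nat.le_induction with
  | base => exact le_rfl
  | succ n hn ih =>
    refine le_trans (le_of_eq ?_) ih
    have h1 := card_factor_mul_relIndex (S := S) n
    have h2 : Nat.card (S.Factor n) = Nat.card (S.Factor (p * n)) :=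
      Nat.card_eq_of_bijective _ ⟨hN.inj n hn, hN.surj n hn⟩
    rw [Subgroup.relIndex_eq_one.2 (term_mul_add_le hN.term_le hn), mul_one, ← h2, mul_comm] at h1
    exact Nat.eq_of_mul_eq_mul_right (Nat.card_pos (α := S.Factor n)) h1

/-- The graded comparison: if `B` contains the `p`-th powers of `A`, then in every degree `n ≥ N`
the `p`-th power embeds the factor of the filtration induced on `A` into that of degree `p * n`
of the filtration induced on `B`. -/
theorem relIndex_inf_le_of_pow_mem (hfin : ∀ i, Finite (S.Factor i)) {N : ℕ}
    (hN : ∀ n, N ≤ n → Function.Injective (S.powFun n)) {A B : Subgroup H}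
    (hAB : ∀ a ∈ A, a ^ p ∈ B) {n : ℕ} (hn : N ≤ n) :
    (S.term n).relIndex (A ⊓ S.term N) ≤ (S.term (p * n)).relIndex (B ⊓ S.term (p * N)) := by
  have hne : ∀ i (K : Subgroup H), (S.term i).relIndex K ≠ 0 := fun i K h =>
    index_term_ne_zero hfin i (Subgroup.index_eq_zero_of_relIndex_eq_zero h)
  have hmul : ∀ (C : Subgroup H) {i j k : ℕ}, i ≤ j → j ≤ k → (S.term k).relIndex (C ⊓ S.term i) =
      (S.term k).relIndex (C ⊓ S.term j) * (S.term j).relIndex (C ⊓ S.term i) := by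
    intro C i j k hij hjk
    have h1 := Subgroup.relIndex_mul_relIndex (C ⊓ S.term k) (C ⊓ S.term j) (C ⊓ S.term i)
      (inf_le_inf_left _ (S.antitone hjk)) (inf_le_inf_left _ (S.antitone hij))
    have h2 : ∀ {a b : ℕ}, a ≤ b → (C ⊓ S.term b).relIndex (C ⊓ S.term a) =
        (S.term b).relIndex (C ⊓ S.term a) := by
      intro a b hab
      rw [← Subgroup.inf_relIndex_right (S.term b), inf_comm (S.term b), inf_assoc,
        inf_eq_right.2 (S.antitone hab)]
    rw [h2 hjk, h2 hij, h2 (hij.trans hjk)] at h1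
    exact h1.symm
  induction n, hn using Nat.le_induction with
  | base =>
    rw [Subgroup.relIndex_eq_one.2 inf_le_right]
    exact Nat.one_le_iff_ne_zero.2 (hne _ _)
  | succ n hn ih =>
    have hp1 := hp.out.one_le
    rw [hmul A hn n.le_succ, hmul B (Nat.mul_le_mul_left p hn) (Nat.mul_le_mul_left p n.le_succ)]
    refine Nat.mul_le_mul ?_ ih
    refine (Subgroup.relIndex_le_of_forall_inv_mul_mem (A := A ⊓ S.term n) (B := B ⊓ S.term (p * n))
      (B' := S.term (p * n + 1)) (fun x => x ^ p)
      (fun x hx => ⟨hAB x hx.1, S.power_mem n x hx.2⟩) ?_ (hne _ _)).trans ?_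
    · exact fun x hx y hy => powFun_injective_iff.1 (hN n hn) x hx.2 y hy.2
    · refine Subgroup.relIndex_le_of_le_left (S.antitone ?_) (hne _ _)
      rw [Nat.succ_eq_add_one, mul_add]
      omega

/-- Sections of exponent `p` have bounded order: if `B ≤ A` is open and contains the `p`-th powers
of `A`, then the index of `B` in `A` is bounded independently of `A` and `B`. -/
theorem PowBijectiveFrom.relIndex_le_of_pow_mem {N : ℕ} (hfin : ∀ i, Finite (S.Factor i))
    (hN : S.PowBijectiveFrom N) {A B : Subgroup H} (hBA : B ≤ A)
    (hAB : ∀ a ∈ A, a ^ p ∈ B) {M : ℕ} (hM : S.term M ≤ B) :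
    B.relIndex A ≤ (S.term N).index * (S.term (p * N)).relIndex (S.term N) := by
  have hne : ∀ i (K : Subgroup H), (S.term i).relIndex K ≠ 0 := fun i K h =>
    index_term_ne_zero hfin i (Subgroup.index_eq_zero_of_relIndex_eq_zero h)
  obtain ⟨n, hn, hnB⟩ : ∃ n, N ≤ n ∧ S.term n ≤ B :=
    ⟨max M N, le_max_right _ _, (S.antitone (le_max_left _ _)).trans hM⟩
  have hpn : n ≤ p * n := Nat.le_mul_of_pos_left _ hp.out.pos
  -- compare `[A : Hₙ] = [A : B] [B : Hₙ]` with `[B : Hₚₙ] = [B : Hₙ] [Hₙ : Hₚₙ]`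
  have h1 := Subgroup.relIndex_mul_relIndex _ _ _ hnB hBA
  have h2 := Subgroup.relIndex_mul_relIndex _ _ _ (S.antitone hpn) hnB
  have h3 : (S.term n).relIndex A =
      (S.term n).relIndex (A ⊓ S.term N) * (S.term N).relIndex A := by
    have := Subgroup.relIndex_inf_mul_relIndex (S.term n) (S.term N) A
    rwa [inf_eq_left.2 (S.antitone hn), inf_comm, eq_comm] at this
  have h4 : (S.term N).relIndex A ≤ (S.term N).index := by
    rw [← Subgroup.relIndex_top_right]
    exact Subgroup.relIndex_le_of_le_right le_top (hne _ _)
  have h5 : (S.term n).relIndex (A ⊓ S.term N) ≤ (S.term (p * n)).relIndex B :=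
    (relIndex_inf_le_of_pow_mem hfin hN.inj hAB hn).trans
      (Subgroup.relIndex_le_of_le_right inf_le_left (hne _ _))
  have h6 := hN.relIndex_le hfin hn
  have h7 : (S.term n).relIndex B * B.relIndex A ≤ (S.term n).relIndex B *
      ((S.term N).index * (S.term (p * N)).relIndex (S.term N)) := by
    calc (S.term n).relIndex B * B.relIndex A
        = (S.term n).relIndex (A ⊓ S.term N) * (S.term N).relIndex A := h1.trans h3
      _ ≤ (S.term (p * n)).relIndex B * (S.term N).index := Nat.mul_le_mul h5 h4
      _ = (S.term (p * n)).relIndex (S.term n) * (S.term n).relIndex B * (S.term N).index := by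
        rw [h2]
      _ ≤ (S.term (p * N)).relIndex (S.term N) * (S.term n).relIndex B * (S.term N).index := by
        gcongr
      _ = _ := by ring
  exact Nat.le_of_mul_le_mul_left h7 (Nat.pos_of_ne_zero (hne _ _))

/-- If the `p`-th power is injective on the factors of large degree and the index of `Hₚₙ` in `Hₙ`
is bounded, then this index, being nondecreasing for large `n`, is eventually constant, which
forces the `p`-th power to be bijective. -/
theorem exists_powBijectiveFrom_of_relIndex_le (hfin : ∀ i, Finite (S.Factor i)) {N C : ℕ}
    (hN : ∀ n, N ≤ n → Function.Injective (S.powFun n))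
    (hC : ∀ n, (S.term (p * n)).relIndex (S.term n) ≤ C) : ∃ N', S.PowBijectiveFrom N' := by
  have hne : ∀ i (K : Subgroup H), (S.term i).relIndex K ≠ 0 := fun i K h =>
    index_term_ne_zero hfin i (Subgroup.index_eq_zero_of_relIndex_eq_zero h)
  have hcard : ∀ n, N ≤ n → Nat.card (S.Factor n) ≤ Nat.card (S.Factor (p * n)) :=
    fun n hn => Nat.card_le_card_of_injective _ (hN n hn)
  obtain ⟨D, hD⟩ : ∃ D : ℕ → ℕ, ∀ n, D n = (S.term (p * n)).relIndex (S.term n) :=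
    ⟨_, fun _ => rfl⟩
  have hstep : ∀ n, N ≤ n → Nat.card (S.Factor n) * D (n + 1) =
      D n * (Nat.card (S.Factor (p * n)) *
        (S.term (p * (n + 1))).relIndex (S.term (p * n + 1))) := by
    intro n hn
    rw [hD, hD]
    exact card_factor_mul_relIndex n
  have hmono : Monotone fun k => D (N + k) := by
    refine monotone_nat_of_le_succ fun k => ?_
    refine Nat.le_of_mul_le_mul_left (?_ : Nat.card (S.Factor (N + k)) * D (N + k) ≤
      Nat.card (S.Factor (N + k)) * D (N + k + 1)) Nat.card_pos
    rw [hstep _ (by omega), mul_comm]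
    exact Nat.mul_le_mul_left _ ((hcard _ (by omega)).trans (Nat.le_mul_of_pos_right _
      (Nat.pos_of_ne_zero (hne _ _))))
  obtain ⟨k₀, hk₀⟩ : ∃ k₀, ∀ k, k₀ ≤ k → D (N + k) = D (N + k₀) := by
    have hbdd : BddAbove (Set.range fun k => D (N + k)) :=
      ⟨C, by rintro _ ⟨k, rfl⟩; exact (hD _).trans_le (hC _)⟩
    obtain ⟨k₀, h⟩ := Nat.sSup_mem (Set.range_nonempty _) hbdd
    exact ⟨k₀, fun k hk => le_antisymm ((le_csSup hbdd ⟨k, rfl⟩).trans_eq h.symm) (hmono hk)⟩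
  have heq : ∀ n, N + k₀ ≤ n → Nat.card (S.Factor (p * n)) = Nat.card (S.Factor n) ∧
      (S.term (p * (n + 1))).relIndex (S.term (p * n + 1)) = 1 := by
    intro n hn
    have h1 := hstep n (by omega)
    have h2 : D (n + 1) = D n := by
      obtain ⟨k, rfl⟩ := Nat.exists_eq_add_of_le hn
      have e1 := hk₀ (k₀ + k) (by omega)
      have e2 := hk₀ (k₀ + k + 1) (by omega)
      rw [← add_assoc] at e1
      rw [← add_assoc, ← add_assoc] at e2
      rw [e1, e2]
    rw [h2, mul_comm] at h1
    have h3 := Nat.eq_of_mul_eq_mul_left (Nat.pos_of_ne_zero (by rw [hD]; exact hne _ _)) h1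
    have h4 := hcard n (by omega)
    have h5 : 0 < Nat.card (S.Factor n) := Nat.card_pos
    have h6 := Nat.pos_of_ne_zero (hne (p * (n + 1)) (S.term (p * n + 1)))
    have h7 : (S.term (p * (n + 1))).relIndex (S.term (p * n + 1)) = 1 := by nlinarith
    rw [h7, mul_one] at h3
    exact ⟨h3.symm, h7⟩
  refine ⟨N + k₀, fun n hn => hN n (by omega), fun n hn => ?_, fun m hm hpm => ?_⟩
  · exact ((Nat.bijective_iff_injective_and_card _).2 ⟨hN n (by omega), (heq n hn).1.symm⟩).2
  · -- `m` lies strictly between two consecutive multiples of `p`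
    have e := Nat.div_add_mod m p
    have hr : m % p ≠ 0 := fun h => hpm (Nat.dvd_of_mod_eq_zero h)
    have hr' := Nat.mod_lt m hp.out.pos
    have hn : N + k₀ ≤ m / p := (Nat.le_div_iff_mul_le hp.out.pos).2 (by rwa [mul_comm])
    have h1 := Subgroup.relIndex_eq_one.1 (heq (m / p) hn).2
    have h2 : m + 1 ≤ p * (m / p + 1) := by rw [mul_add]; omega
    exact (S.antitone (by omega)).trans (h1.trans (S.antitone h2))

/-- The Lie algebra of the characteristic core inherits finite rank: the terms `Uₙ ≥ Uₚₙ` of the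
core form a section of exponent `p`, hence of bounded order. -/
theorem charCore_exists_powBijectiveFrom (hfin : ∀ i, Finite (S.Factor i))
    (htop : S.topology = pTopology p H) {N : ℕ} (hN : S.PowBijectiveFrom N) :
    (∀ i, Finite (S.charCore.Factor i)) ∧ ∃ N', S.charCore.PowBijectiveFrom N' := by
  have hfin' : ∀ i, Finite (S.charCore.Factor i) := finite_factor_of_index_ne_zero fun i h => by
    obtain ⟨M, hM⟩ := exists_term_le_charCore htop i
    have := Subgroup.index_dvd_of_le hM
    rw [h, zero_dvd_iff] at this
    exact index_term_ne_zero hfin M this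
  refine ⟨hfin', exists_powBijectiveFrom_of_relIndex_le hfin'
    (C := (S.term N).index * (S.term (p * N)).relIndex (S.term N))
    (fun n hn => charCore_powFun_injective (hN.inj n hn)) fun n => ?_⟩
  obtain ⟨M, hM⟩ := exists_term_le_charCore htop (p * n)
  exact hN.relIndex_le_of_pow_mem hfin
    (S.charCore.antitone (Nat.le_mul_of_pos_left n hp.out.pos)) (S.charCore.power_mem n) hM

end PSeries

theorem mainTheorem7 (p : ℕ) [Fact p.Prime] {H : Type*} [Group H] [Group.FG H]
    (S : PSeries p H) (hS : ⨅ i, S.term i = ⊥) (htop : S.topology = pTopology p H) :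
    ((∃ r, S.IsAbelianOfRank r) →
      ∃ U : PSeries p H, (∀ i, (U.term i).Characteristic) ∧ ⨅ i, U.term i = ⊥ ∧
        ∃ r, U.IsAbelianOfRank r) ∧
    ((∃ r, S.IsFreeAbelianOfRank r) →
      ∃ U : PSeries p H, (∀ i, (U.term i).Characteristic) ∧ ⨅ i, U.term i = ⊥ ∧
        ∃ r, U.IsFreeAbelianOfRank r) := by
  have hbot : ⨅ i, S.charCore.term i = ⊥ := by
    rw [eq_bot_iff, ← hS]
    exact iInf_mono PSeries.charCore_le
  constructor
  · rintro ⟨r, hr⟩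
    obtain ⟨hfin, N, hN⟩ := hr.exists_powBijectiveFrom
    obtain ⟨hfin', N', hN'⟩ := PSeries.charCore_exists_powBijectiveFrom hfin htop hN
    exact ⟨S.charCore, PSeries.charCore_characteristic, hbot,
      hN'.exists_isAbelianOfRank (PSeries.charCore_isLieAbelian hr.1) hfin'⟩
  · rintro ⟨r, hr⟩
    obtain ⟨hfin, N, hN⟩ := hr.isAbelianOfRank.exists_powBijectiveFrom
    obtain ⟨hfin', N', hN'⟩ := PSeries.charCore_exists_powBijectiveFrom hfin htop hN
    exact ⟨S.charCore, PSeries.charCore_characteristic, hbot,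
      hN'.exists_isFreeAbelianOfRank (PSeries.charCore_isLieAbelian hr.isAbelianOfRank.1) hfin'
        fun n => PSeries.charCore_powFun_injective (hr.powFun_injective n)⟩
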